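/- Let $d\ge 2$ and let $(X,r)$ be a finite solution of the Yang–Baxter equation of order $n\ge 1$: $X$ is a set with $n$ elements and $r:X\times X\to X\times X$, written $r(x,y)=({}^xy,x^y)$, is an involution satisfying $r^{12}r^{23}r^{12}=r^{23}r^{12}r^{23}$ on $X^3$ (where $r^{12}=r\times\mathrm{id}$, $r^{23}=\mathrm{id}\times r$) such that all maps $y\mapsto{}^xy$ and $x\mapsto x^y$ are bijective. Fix any total order on $X$ and let $<$ be the induced degree-lexicographic order on the free monoid $\langle X\rangle$; $\mathbf{LM}(f)$ denotes the leading monomial of $f\in \mathbf k\langle X\rangle$, $\mathbf k$ a field. Let $\mathcal A=\mathbf k\langle X\rangle/I$ be the Yang–Baxter algebra, where $I$ is the two-sided ideal generated by all $xy-y'x'$ with $r(x,y)=(y',x')\neq(x,y)$. Grade $\mathcal A=\bigoplus_m\mathcal A_m$ by length and let $\mathcal A^{(d)}=\bigoplus_m \mathcal A_{md}$ be its $d$-Veronese subalgebra, with degree-$m$ component $\mathcal A_{md}$. A word is normal if it contains no $\mathbf{LM}(f)$ with $0\ne f\in I$ as a subword; $\mathcal N_m$ is the set of normal words of length $m$,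 and $\mathrm{Nor}(w)$ is the normal form of a word $w$ modulo $I$, which is the unique normal word congruent to $w$ modulo $I$ and has the same length as $w$. Extend $r$ to words by ${}^{ab}u={}^a({}^bu)$, ${}^a(uv)=({}^au)({}^{a^u}v)$, $a^{uv}=(a^u)^v$, $(ab)^u=(a^{{}^bu})(b^u)$ (the empty word acts trivially and is fixed by all actions), and let $\rho:\mathcal N_d\times\mathcal N_d\to\mathcal N_d\times\mathcal N_d$, $\rho(a,b)=(\mathrm{Nor}({}^ab),\mathrm{Nor}(a^b))$. Put $N=\binom{n+d-1}{d}$, write $\mathcal N_d=\{w_1<w_2<\cdots\}$, write $\cdot(a,b)$ for the word $ab$, and for pairs of indices of elements of $\mathcal N_d$ set $$\mathcal H=\{(j,i)\mid \rho(w_j,w_i)=(w_{i'},w_{j'}),\ w_j>w_{i'}\},\qquad \mathrm P=\{(i,j)\mid \cdot\rho(w_i,w_j)\ge w_iw_j\},$$ $$\mathrm C=\{(i,j)\in \mathrm P\mid w_iw_j\in\mathcal N_{2d}\},\qquad \mathrm{MV}=\{(i,j)\in \mathrm P\mid w_iw_j\notin\mathcal N_{2d}\}.$$ Then $|\mathcal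 N_d|=N$, and $\mathcal A^{(d)}$ is a quadratic algebra whose one-generators are the elements of $\mathcal N_d$ (their classes form a basis of $\mathcal A_d$), subject to a set $\mathcal R$ of $N^2-\binom{n+2d-1}{n-1}$ linearly independent quadratic relations; that is, the algebra homomorphism $\mathbf k\langle\mathcal N_d\rangle\to\mathcal A$ sending each $w\in\mathcal N_d$ to its class maps the degree-$m$ component onto $\mathcal A_{md}$ for every $m$, has image $\mathcal A^{(d)}$, and has as kernel the two-sided ideal generated by $\mathcal R$. (Linear independence holds in $\mathbf k\langle\mathcal N_d\rangle$, and also in $\mathbf k\langle X\rangle$ after expanding the $w_i$ as words in $X$; leading monomials below are taken in $\mathbf k\langle X\rangle$.) Precisely: 1. $\mathcal R=\mathcal R_a\cup\mathcal R_b$ is a disjoint union, where: (a) $\mathcal R_a=\{g_{ji}=w_jw_i-w_{i'}w_{j'}\mid (j,i)\in\mathcal H,\ (w_{i'},w_{j'})=\rho(w_j,w_i)\}$ has $\binom N2$ elements. The map $\rho$ is an involution and each of its nontrivial orbits contains exactly one pair $(w_j,w_i)$ with $(j,i)\in\mathcal H$; each monomial $w_iw_j$ with $(w_i,w_j)$ in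 a nontrivial $\rho$-orbit occurs in exactly one element of $\mathcal R_a$; and $\mathbf{LM}(g_{ji})=w_jw_i>w_{i'}w_{j'}$ for all $(j,i)\in\mathcal H$. (b) $\mathcal R_b=\{g_{ij}=w_iw_j-w_{i_0}w_{j_0}\mid (i,j)\in\mathrm{MV}\}$ has $\binom{N+1}2-\binom{n+2d-1}{n-1}$ elements, where for each $(i,j)\in\mathrm{MV}$ the pair $(i_0,j_0)$ is the unique element of $\mathrm C$ with $w_{i_0}w_{j_0}=\mathrm{Nor}(w_iw_j)$; and $\mathbf{LM}(g_{ij})=w_iw_j>w_{i_0}w_{j_0}$. 2. $\mathcal A^{(d)}$ has a second set $\mathcal R_1=\mathcal R_{1a}\cup\mathcal R_b$ (a disjoint union) of linearly independent defining quadratic relations on the same generators, where $\mathcal R_{1a}=\{f_{ji}=w_jw_i-w_{i''}w_{j''}\mid (j,i)\in\mathcal H\}$ has exactly $\binom N2$ elements; for each $(j,i)\in\mathcal H$ the pair $(i'',j'')$ is the unique element of $\mathrm C$ with $w_{i''}w_{j''}=\mathrm{Nor}(w_jw_i)$, and $\mathbf{LM}(f_{ji})=w_jw_i>w_{i''}w_{j''}$.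 3. $\mathcal R$ and $\mathcal R_1$ are equivalent: they span the same subspace of, and generate the same two-sided ideal in, $\mathbf k\langle\mathcal N_d\rangle$. -/

import Mathlib

namespace YBVeronese

noncomputable section

/-! ### Set-theoretic solutions of the Yang--Baxter equation -/

/-- `r × id` on `X × X × X`. -/
def r12 {X : Type*} (r : X × X → X × X) (t : X × X × X) : X × X × X :=
  ((r (t.1, t.2.1)).1, (r (t.1, t.2.1)).2, t.2.2)

/-- `id × r` on `X × X × X`. -/
def r23 {X : Type*} (r : X × X → X × X) (t : X × X × X) : X × X × X :=
  (t.1, r t.2)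

/-- `(X, r)` is a nondegenerate symmetric set (a "solution"). Writing `r(x,y) = (ˣy, xʸ)`, the maps
`y ↦ ˣy` and `x ↦ xʸ` are bijective, `r` is an involution, and `r` satisfies the braid relation. -/
structure IsSolution {X : Type*} (r : X × X → X × X) : Prop where
  left_bijective : ∀ x : X, Function.Bijective (fun y : X => (r (x, y)).1)
  right_bijective : ∀ y : X, Function.Bijective (fun x : X => (r (x, y)).2)
  involutive : Function.Involutive r
  braid : r12 r ∘ r23 r ∘ r12 r = r23 r ∘ r12 r ∘ r23 r

/-! ### Free associative algebras, the degree-lexicographic order, normal monomials -/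

/-- The free associative unital algebra `k⟨Y⟩`, with the words in `Y` as a basis. -/
abbrev Free (k Y : Type*) [Field k] : Type _ := MonoidAlgebra k (FreeMonoid Y)

/-- A word, as an element of the free algebra. -/
abbrev mon (k : Type*) [Field k] {Y : Type*} (w : FreeMonoid Y) : Free k Y :=
  MonoidAlgebra.of k (FreeMonoid Y) w

/-- The homogeneous component of degree `m` of `k⟨Y⟩`: the span of the words of length `m`. -/
def homog (k Y : Type*) [Field k] (m : ℕ) : Submodule k (Free k Y) :=
  Submodule.span k (mon k '' {w : FreeMonoid Y | w.length = m})

/-- The degree-lexicographic order on words: `u < v`. -/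
def DegLex {X : Type*} [LinearOrder X] (u v : FreeMonoid X) : Prop :=
  List.Shortlex (· < ·) u.toList v.toList

/-- `u` is the leading monomial of `f`, `LM(f) = u`. -/
def IsLM {k X : Type*} [Field k] [LinearOrder X] (f : Free k X) (u : FreeMonoid X) : Prop :=
  f.coeff u ≠ 0 ∧ ∀ v, f.coeff v ≠ 0 → v ≠ u → DegLex v u

/-- `u` is normal modulo the ideal `I`: it contains no `LM(f)`, `f ∈ I`, as a subword. -/
def IsNormal {k X : Type*} [Field k] [LinearOrder X] (I : TwoSidedIdeal (Free k X))
    (u : FreeMonoid X) : Prop :=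
  ∀ f ∈ I, ∀ v, IsLM f v → ∀ a b, u ≠ a * v * b

/-! ### The Yang--Baxter algebra -/

/-- The defining relations `xy - y'x'`, one for each `(x,y)` with `r(x,y) = (y',x') ≠ (x,y)`. -/
def ybRelations (k : Type*) {X : Type*} [Field k] (r : X × X → X × X) : Set (Free k X) :=
  {f | ∃ x y y' x' : X, r (x, y) = (y', x') ∧ (x, y) ≠ (y', x') ∧
    f = mon k (FreeMonoid.of x * FreeMonoid.of y) - mon k (FreeMonoid.of y' * FreeMonoid.of x')}

/-- The two-sided ideal generated by the defining relations. -/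
def ybIdeal (k : Type*) {X : Type*} [Field k] (r : X × X → X × X) : TwoSidedIdeal (Free k X) :=
  TwoSidedIdeal.span (ybRelations k r)

/-- The Yang--Baxter algebra `A(k, X, r)`, the quotient of `k⟨X⟩` by that ideal. -/
abbrev YBAlgebra (k : Type*) {X : Type*} [Field k] (r : X × X → X × X) : Type _ :=
  (ybIdeal k r).ringCon.Quotient

/-- The canonical projection `k⟨X⟩ → A(k, X, r)`. -/
def ybMk (k : Type*) {X : Type*} [Field k] (r : X × X → X × X) :
    Free k X →ₐ[k] YBAlgebra k r :=
  (ybIdeal k r).ringCon.mkₐ (α := k)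

/-- The graded component `A_m`, spanned by the classes of the words of length `m`. -/
def ybComp (k : Type*) {X : Type*} [Field k] (r : X × X → X × X) (m : ℕ) :
    Submodule k (YBAlgebra k r) :=
  (homog k X m).map (ybMk k r).toLinearMap

theorem one_mem_ybComp (k : Type*) {X : Type*} [Field k] (r : X × X → X × X) :
    (1 : YBAlgebra k r) ∈ ybComp k r 0 := by
  refine ⟨1, Submodule.subset_span ⟨1, by simp, ?_⟩, ?_⟩
  · exact map_one _
  · simp

theorem ybComp_mul_le (k : Type*) {X : Type*} [Field k] (r : X × X → X × X) (p q : ℕ) :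
    ybComp k r p * ybComp k r q ≤ ybComp k r (p + q) := by
  unfold ybComp homog
  rw [← Submodule.map_mul, Submodule.span_mul_span]
  refine Submodule.map_mono (Submodule.span_mono ?_)
  rintro _ ⟨_, ⟨u, hu, rfl⟩, _, ⟨v, hv, rfl⟩, rfl⟩
  refine ⟨u * v, ?_, map_mul _ _ _⟩
  simp only [Set.mem_ofPred_eq] at hu hv ⊢
  rw [FreeMonoid.length_mul, hu, hv]

/-- The `d`-Veronese subalgebra `A^(d)`, the sum of the components `A_{md}`, `m ≥ 0`. -/
def veronese (k : Type*) {X : Type*} [Field k] (r : X × X → X × X) (d : ℕ) :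
    Subalgebra k (YBAlgebra k r) :=
  (⨆ m : ℕ, ybComp k r (m * d)).toSubalgebra
    (Submodule.mem_iSup_of_mem 0 (by simpa using one_mem_ybComp k r))
    (by
      intro a b ha hb
      have h : (⨆ m : ℕ, ybComp k r (m * d)) * (⨆ m : ℕ, ybComp k r (m * d))
          ≤ ⨆ m : ℕ, ybComp k r (m * d) := by
        rw [Submodule.iSup_mul]
        refine iSup_le fun p => ?_
        rw [Submodule.mul_iSup]
        refine iSup_le fun q => (ybComp_mul_le k r _ _).trans ?_
        rw [← add_mul]
        exact le_iSup (fun m : ℕ => ybComp k r (m * d)) (p + q)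
      exact h (Submodule.mul_mem_mul ha hb))

/-! ### Normal forms of words: existence and uniqueness -/

/-- The sort key `(length, word)` that turns the degree-lexicographic order into a linear order. -/
def key {X : Type*} (u : FreeMonoid X) : ℕ ×ₗ List X := toLex (u.length, u.toList)

theorem key_injective {X : Type*} : Function.Injective (key (X := X)) := by
  intro u v h
  have h' := congrArg (fun z => (ofLex z).2) h
  exact FreeMonoid.toList.injective h'

theorem degLex_iff {X : Type*} [LinearOrder X] (u v : FreeMonoid X) :
    DegLex u v ↔ key u < key v := by
  unfold DegLex key
  rw [List.shortlex_def, Prod.Lex.toLex_lt_toLex]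
  rfl

theorem DegLex.mul_mul {X : Type*} [LinearOrder X] {u v : FreeMonoid X} (h : DegLex u v)
    (hl : u.length = v.length) (a b : FreeMonoid X) : DegLex (a * u * b) (a * v * b) := by
  unfold DegLex at *
  have hl' : u.toList.length = v.toList.length := hl
  rw [List.shortlex_iff_lex hl'] at h
  simp only [FreeMonoid.toList_mul]
  rw [List.shortlex_iff_lex (by simp [hl']), List.append_assoc, List.append_assoc]
  refine List.Lex.append_left _ ?_ _
  clear hl
  generalize u.toList = s at *
  generalize v.toList = t at *
  induction h with
  | nil => simp at hl'
  | cons h ih => exact List.Lex.cons (ih (by simpa using hl'))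
  | rel h => exact List.Lex.rel h

theorem exists_isLM {k X : Type*} [Field k] [LinearOrder X] {f : Free k X} (hf : f ≠ 0) :
    ∃ u, IsLM f u := by
  have hne : f.coeff.support.Nonempty := by
    rw [Finsupp.support_nonempty_iff]
    exact fun h => hf (MonoidAlgebra.coeff_injective h)
  obtain ⟨u, hu, hmax⟩ := Finset.exists_max_image f.coeff.support key hne
  refine ⟨u, by simpa using hu, fun v hv hvu => ?_⟩
  rw [degLex_iff]
  exact lt_of_le_of_ne (hmax v (by simpa using hv)) (fun h => hvu (key_injective h))

/-- The congruence `w ~ u` iff `w - u` lies in the ideal generated by the defining relations. -/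
def wordCon (k : Type*) {X : Type*} [Field k] (r : X × X → X × X) : Con (FreeMonoid X) :=
  Con.ker ((ybMk k r : Free k X →* YBAlgebra k r).comp (MonoidAlgebra.of k (FreeMonoid X)))

theorem ybMk_eq_iff {k X : Type*} [Field k] {r : X × X → X × X} {f g : Free k X} :
    ybMk k r f = ybMk k r g ↔ f - g ∈ ybIdeal k r := by
  rw [← TwoSidedIdeal.rel_iff]
  exact RingCon.eq _

theorem wordCon_iff {k X : Type*} [Field k] {r : X × X → X × X} {w u : FreeMonoid X} :
    wordCon k r w u ↔ mon k w - mon k u ∈ ybIdeal k r :=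
  ybMk_eq_iff

/-- The congruence on words generated by `xy ~ y'x'` for `r(x,y) = (y',x')`; it preserves length. -/
def ybCon {X : Type*} (r : X × X → X × X) : Con (FreeMonoid X) :=
  conGen fun w u => ∃ x y : X, w = FreeMonoid.of x * FreeMonoid.of y ∧
    u = FreeMonoid.of (r (x, y)).1 * FreeMonoid.of (r (x, y)).2

theorem ybCon_length {X : Type*} {r : X × X → X × X} {w u : FreeMonoid X} (h : ybCon r w u) :
    w.length = u.length := by
  induction h with
  | of w u h => obtain ⟨x, y, rfl, rfl⟩ := h; simp
  | refl => rfl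
  | symm _ ih => exact ih.symm
  | trans _ _ ih1 ih2 => exact ih1.trans ih2
  | mul _ _ ih1 ih2 => simp [ih1, ih2]

theorem ybCon_le (k : Type*) {X : Type*} [Field k] (r : X × X → X × X) :
    ybCon r ≤ wordCon k r := by
  refine Con.conGen_le.2 ?_
  rintro w u ⟨x, y, rfl, rfl⟩
  rw [wordCon_iff]
  by_cases h : (x, y) = r (x, y)
  · rw [← h, sub_self]
    exact zero_mem _
  · exact TwoSidedIdeal.subset_span ⟨x, y, _, _, rfl, h, rfl⟩

/-- A leading monomial of an element of the ideal is congruent to a smaller word. -/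
theorem exists_smaller {k X : Type*} [Field k] [LinearOrder X] {r : X × X → X × X}
    {f : Free k X} (hf : f ∈ ybIdeal k r) {v : FreeMonoid X} (hv : IsLM f v) :
    ∃ v', ybCon r v v' ∧ DegLex v' v := by
  classical
  let π : Free k X →+* MonoidAlgebra k (ybCon r).Quotient :=
    MonoidAlgebra.mapDomainRingHom k (ybCon r).mk'
  have hπ : ybIdeal k r ≤ TwoSidedIdeal.ker π := by
    refine TwoSidedIdeal.span_le.2 ?_
    rintro _ ⟨x, y, y', x', h, -, rfl⟩
    have hc : (ybCon r).mk' (FreeMonoid.of x * FreeMonoid.of y)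
        = (ybCon r).mk' (FreeMonoid.of y' * FreeMonoid.of x') :=
      (Con.eq _).2 (ConGen.Rel.of _ _ ⟨x, y, rfl, by rw [h]⟩)
    simp only [SetLike.mem_coe, TwoSidedIdeal.mem_ker, map_sub, π, mon, MonoidAlgebra.of_apply,
      MonoidAlgebra.mapDomainRingHom_apply, MonoidAlgebra.mapDomain_single]
    rw [hc, sub_self]
  have h0 : π f = 0 := (TwoSidedIdeal.mem_ker _).1 (hπ hf)
  by_contra! hcon
  have h1 : (π f).coeff ((ybCon r).mk' v) = f.coeff v := by
    have e : (π f).coeff = Finsupp.mapDomain (ybCon r).mk' f.coeff := rfl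
    rw [e, Finsupp.mapDomain, Finsupp.sum_apply, Finsupp.sum, Finset.sum_eq_single v]
    · simp
    · intro v' hv' hne
      rw [Finsupp.single_apply, if_neg]
      intro hq
      exact hcon v' ((Con.eq _).1 hq.symm) (hv.2 v' (by simpa using hv') hne)
    · intro h
      simp [Finsupp.notMem_support_iff.1 h]
  rw [h0] at h1
  exact hv.1 h1.symm

theorem exists_normalForm (k : Type*) {X : Type*} [Field k] [Fintype X] [LinearOrder X]
    (r : X × X → X × X) (w : FreeMonoid X) :
    ∃ u : FreeMonoid X, u.length = w.length ∧ IsNormal (ybIdeal k r) u ∧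
      mon k w - mon k u ∈ ybIdeal k r := by
  have hfin : {u : FreeMonoid X | ybCon r w u}.Finite :=
    (List.finite_length_eq X w.length).subset fun u hu => (ybCon_length hu).symm
  obtain ⟨u, hu, hmin⟩ := Set.exists_min_image _ key hfin ⟨w, (ybCon r).refl w⟩
  refine ⟨u, (ybCon_length hu).symm, ?_, wordCon_iff.1 (ybCon_le k r hu)⟩
  rintro f hf v hv a b rfl
  obtain ⟨v', hc, hlt⟩ := exists_smaller hf hv
  have h1 : ybCon r w (a * v' * b) :=
    (ybCon r).trans hu ((ybCon r).mul ((ybCon r).mul ((ybCon r).refl a) hc) ((ybCon r).refl b))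
  exact absurd ((degLex_iff _ _).1 (hlt.mul_mul (ybCon_length hc).symm a b))
    (not_lt.2 (hmin _ h1))

theorem normalForm_unique {k X : Type*} [Field k] [LinearOrder X] (I : TwoSidedIdeal (Free k X))
    (f g h : Free k X) (hg : ∀ v, g.coeff v ≠ 0 → IsNormal I v) (hfg : f - g ∈ I)
    (hh : ∀ v, h.coeff v ≠ 0 → IsNormal I v) (hfh : f - h ∈ I) : g = h := by
  by_contra hne
  have hI : g - h ∈ I := by
    have := I.sub_mem hfh hfg
    rwa [sub_sub_sub_cancel_left] at this
  obtain ⟨v, hv⟩ := exists_isLM (sub_ne_zero.2 hne)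
  have hvn : IsNormal I v := by
    by_cases h1 : g.coeff v = 0
    · refine hh v fun h2 => hv.1 ?_
      simp [h1, h2]
    · exact hg v h1
  exact hvn _ hI v hv 1 1 (by simp)

/-- The normal form `Nor(w)` of a word `w` modulo the ideal of relations: the normal word that is
congruent to `w` modulo the ideal (it is a word of the same length as `w`). -/
def norWord (k : Type*) {X : Type*} [Field k] [Fintype X] [LinearOrder X] (r : X × X → X × X)
    (w : FreeMonoid X) : FreeMonoid X :=
  (exists_normalForm k r w).choose

theorem norWord_spec (k : Type*) {X : Type*} [Field k] [Fintype X] [LinearOrder X]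
    (r : X × X → X × X) (w : FreeMonoid X) :
    (norWord k r w).length = w.length ∧ IsNormal (ybIdeal k r) (norWord k r w) ∧
      mon k w - mon k (norWord k r w) ∈ ybIdeal k r :=
  (exists_normalForm k r w).choose_spec

/-- The set `𝒩_m` of normal words of length `m`. -/
abbrev NormalWord (k : Type*) {X : Type*} [Field k] [LinearOrder X] (r : X × X → X × X)
    (m : ℕ) : Type _ :=
  {u : FreeMonoid X // IsNormal (ybIdeal k r) u ∧ u.length = m}

/-! ### The braided monoid actions and the normalized Veronese solution -/

/-- For a letter `c` and a word `b`, the pair `(ᶜb, cᵇ)`: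
`ᶜ(y b) = (ᶜy)(^{c^y} b)` and `c^{y b} = (c^y)^b`. -/
def letterBraid {X : Type*} (r : X × X → X × X) : X → List X → List X × X
  | c, [] => ([], c)
  | c, y :: b =>
    ((r (c, y)).1 :: (letterBraid r (r (c, y)).2 b).1, (letterBraid r (r (c, y)).2 b).2)

/-- For words `a`, `b`, the pair `(ᵃb, aᵇ)`:
`^{x a} b = ˣ(ᵃb)` and `(x a)^b = (x^{ᵃb})(a^b)`. -/
def wordBraid {X : Type*} (r : X × X → X × X) : List X → List X → List X × List X
  | [], b => (b, [])
  | x :: a, b =>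
    ((letterBraid r x (wordBraid r a b).1).1,
      (letterBraid r x (wordBraid r a b).1).2 :: (wordBraid r a b).2)

/-- The left action `ᵃb` of words on words. -/
def leftAct {X : Type*} (r : X × X → X × X) (a b : FreeMonoid X) : FreeMonoid X :=
  FreeMonoid.ofList (wordBraid r a.toList b.toList).1

/-- The right action `aᵇ` of words on words. -/
def rightAct {X : Type*} (r : X × X → X × X) (a b : FreeMonoid X) : FreeMonoid X :=
  FreeMonoid.ofList (wordBraid r a.toList b.toList).2

theorem letterBraid_length {X : Type*} (r : X × X → X × X) (b : List X) :
    ∀ c : X, (letterBraid r c b).1.length = b.length := by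
  induction b with
  | nil => intro c; rfl
  | cons y b ih => intro c; simp [letterBraid, ih]

theorem wordBraid_length {X : Type*} (r : X × X → X × X) (a b : List X) :
    (wordBraid r a b).1.length = b.length ∧ (wordBraid r a b).2.length = a.length := by
  induction a with
  | nil => exact ⟨rfl, rfl⟩
  | cons x a ih => simp [wordBraid, letterBraid_length, ih.1, ih.2]

theorem leftAct_length {X : Type*} (r : X × X → X × X) (a b : FreeMonoid X) :
    (leftAct r a b).length = b.length :=
  (wordBraid_length r a.toList b.toList).1

theorem rightAct_length {X : Type*} (r : X × X → X × X) (a b : FreeMonoid X) :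
    (rightAct r a b).length = a.length :=
  (wordBraid_length r a.toList b.toList).2

/-- The normalized `d`-Veronese solution `ρ_d(a, b) = (Nor(ᵃb), Nor(aᵇ))` on `𝒩_d`. -/
def rho (k : Type*) {X : Type*} [Field k] [Fintype X] [LinearOrder X] (r : X × X → X × X) (d : ℕ)
    (p : NormalWord k r d × NormalWord k r d) : NormalWord k r d × NormalWord k r d :=
  (⟨norWord k r (leftAct r p.1.1 p.2.1), (norWord_spec k r _).2.1, by
      rw [(norWord_spec k r _).1, leftAct_length, p.2.2.2]⟩,
    ⟨norWord k r (rightAct r p.1.1 p.2.1), (norWord_spec k r _).2.1, by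
      rw [(norWord_spec k r _).1, rightAct_length, p.1.2.2]⟩)

/-! ### The index sets; a pair of indices `(i, j)` is encoded by the pair of words `(w_i, w_j)` -/

/-- The concatenation `w_i w_j` in the free monoid on `X`. -/
def concat {k X : Type*} [Field k] [LinearOrder X] {r : X × X → X × X} {d : ℕ}
    (p : NormalWord k r d × NormalWord k r d) : FreeMonoid X :=
  p.1.1 * p.2.1

/-- `H(n,d)`: the pairs `(w_j, w_i)` with `ρ(w_j, w_i) = (w_{i'}, w_{j'})` and `w_j > w_{i'}`. -/
def setH (k : Type*) {X : Type*} [Field k] [Fintype X] [LinearOrder X] (r : X × X → X × X)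
    (d : ℕ) : Set (NormalWord k r d × NormalWord k r d) :=
  {p | DegLex (rho k r d p).1.1 p.1.1}

/-- `P(n,d)`: the pairs with `w_i w_j ≤ ·ρ(w_i, w_j)`. -/
def setP (k : Type*) {X : Type*} [Field k] [Fintype X] [LinearOrder X] (r : X × X → X × X)
    (d : ℕ) : Set (NormalWord k r d × NormalWord k r d) :=
  {p | DegLex (concat p) (concat (rho k r d p)) ∨ concat p = concat (rho k r d p)}

/-- `C(n,d)`: the pairs in `P(n,d)` for which `w_i w_j` is normal. -/
def setC (k : Type*) {X : Type*} [Field k] [Fintype X] [LinearOrder X] (r : X × X → X × X)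
    (d : ℕ) : Set (NormalWord k r d × NormalWord k r d) :=
  {p | p ∈ setP k r d ∧ IsNormal (ybIdeal k r) (concat p)}

/-- `MV(n,d)`: the pairs in `P(n,d)` for which `w_i w_j` is not normal. -/
def setMV (k : Type*) {X : Type*} [Field k] [Fintype X] [LinearOrder X] (r : X × X → X × X)
    (d : ℕ) : Set (NormalWord k r d × NormalWord k r d) :=
  {p | p ∈ setP k r d ∧ ¬ IsNormal (ybIdeal k r) (concat p)}

/-! ### The relations, as elements of the free algebra on the set `𝒩_d` of generators -/

/-- The quadratic word `w_i w_j` in the generators. -/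
def pairWord {Y : Type*} (p : Y × Y) : FreeMonoid Y := FreeMonoid.of p.1 * FreeMonoid.of p.2

/-- The binomial `w_i w_j - w_s w_t`, for `p = (w_i, w_j)` and `q = (w_s, w_t)`. -/
def binomial (k : Type*) {Y : Type*} [Field k] (p q : Y × Y) : Free k Y :=
  mon k (pairWord p) - mon k (pairWord q)

/-- `R_a`: the relations `w_j w_i - w_{i'} w_{j'}`, `(w_j, w_i) ∈ H(n,d)`,
`(w_{i'}, w_{j'}) = ρ(w_j, w_i)`. -/
def relA (k : Type*) {X : Type*} [Field k] [Fintype X] [LinearOrder X] (r : X × X → X × X)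
    (d : ℕ) : Set (Free k (NormalWord k r d)) :=
  {g | ∃ p ∈ setH k r d, g = binomial k p (rho k r d p)}

/-- `R_b`: the relations `w_i w_j - w_{i₀} w_{j₀}`, `(w_i, w_j) ∈ MV(n,d)`,
`(w_{i₀}, w_{j₀}) ∈ C(n,d)`, `w_{i₀} w_{j₀} = Nor(w_i w_j)`. -/
def relB (k : Type*) {X : Type*} [Field k] [Fintype X] [LinearOrder X] (r : X × X → X × X)
    (d : ℕ) : Set (Free k (NormalWord k r d)) :=
  {g | ∃ p ∈ setMV k r d, ∃ q ∈ setC k r d, concat q = norWord k r (concat p) ∧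
    g = binomial k p q}

/-- `R_{1a}`: the relations `w_j w_i - w_{i''} w_{j''}`, `(w_j, w_i) ∈ H(n,d)`,
`(w_{i''}, w_{j''}) ∈ C(n,d)`, `w_{i''} w_{j''} = Nor(w_j w_i)`. -/
def relA' (k : Type*) {X : Type*} [Field k] [Fintype X] [LinearOrder X] (r : X × X → X × X)
    (d : ℕ) : Set (Free k (NormalWord k r d)) :=
  {g | ∃ p ∈ setH k r d, ∃ q ∈ setC k r d, concat q = norWord k r (concat p) ∧
    g = binomial k p q}

/-! ### Presentations of graded algebras by generators and quadratic relations -/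

/-- The algebra homomorphism `k⟨Y⟩ → A` sending each generator `y` to `gen y`. -/
def evalHom {k Y A : Type*} [Field k] [Ring A] [Algebra k A] (gen : Y → A) : Free k Y →ₐ[k] A :=
  MonoidAlgebra.lift k A (FreeMonoid Y) (FreeMonoid.lift gen)

/-- The expansion `k⟨𝒩_d⟩ → k⟨X⟩`, which reads a normal word of length `d` as a word in `X`. -/
def expand (k : Type*) {X : Type*} [Field k] [LinearOrder X] (r : X × X → X × X) (d : ℕ) :
    Free k (NormalWord k r d) →ₐ[k] Free k X :=
  evalHom fun w => mon k w.1

/-- The element of `A` given by a normal word of length `d`. -/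
def veroneseGen (k : Type*) {X : Type*} [Field k] [LinearOrder X] (r : X × X → X × X) (d : ℕ)
    (w : NormalWord k r d) : YBAlgebra k r :=
  ybMk k r (mon k w.1)

/-- The subalgebra `B` of `A`, graded by the subspaces `𝓑 m`, is the quadratic algebra with
one-generators `gen` (a basis of the component of degree one) and defining quadratic relations
`R`, that is, `k⟨Y⟩ / (R) ≅ B` as graded algebras. -/
structure IsQuadraticPresentation {k Y A : Type*} [Field k] [Ring A] [Algebra k A]
    (B : Subalgebra k A) (𝓑 : ℕ → Submodule k A) (gen : Y → A) (R : Set (Free k Y)) : Prop where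
  grading_indep : iSupIndep 𝓑
  grading_sup : ⨆ m, 𝓑 m = Subalgebra.toSubmodule B
  gen_linearIndependent : LinearIndependent k gen
  gen_span : Submodule.span k (Set.range gen) = 𝓑 1
  range_eq : (evalHom gen : Free k Y →ₐ[k] A).range = B
  graded : ∀ m, (homog k Y m).map (evalHom gen : Free k Y →ₐ[k] A).toLinearMap = 𝓑 m
  quadratic : R ⊆ homog k Y 2
  ker_eq : TwoSidedIdeal.ker (evalHom gen : Free k Y →ₐ[k] A) = TwoSidedIdeal.span R

end

end YBVeronese

/-! Everything rests on the bijective cocycle π from words to finite multisets of letters, with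
π(uv) = π(u) + ᵘπ(v). The braid relation and involutivity make both the left action and π constant
on classes of congruent words. Conversely π separates classes and is onto (`ybCon_iff`,
`cocycle_surjective`). So the Yang–Baxter monoid is in bijection with finite multisets, left
divisibility becomes inclusion, and left cancellation holds. An element of k⟨X⟩ lies in the ideal
exactly when its coefficients sum to zero over each fibre of π (`mem_ybIdeal_iff`). Normal words are
the least words of their classes, hence those of length m are counted by multisets of size m.

For ρ(a,b) = (a',b') the product ab and a'b' are congruent and π(a') = ᵃπ(b). By left cancellation a
pair is determined by its first entry and the class of its product. This gives involutivity of ρ,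
exactly one fixed pair (a,b) for each a, and a strict comparison of first entries on every
nontrivial orbit. Hence P is the complement of H and all cardinalities follow by counting. Linear
independence holds because the leading monomials are distinct. The two sets of relations are
equivalent because the difference of p - ρ(p) and p - Nor(p) is ρ(p) - Nor(p), which is zero or in
R_b.

The quadratic relations generate the whole kernel (`mon_sub_mon_mem_of_cocycle_eq`) by a common
multiple argument. If wV and w'V' have the same multiset M, with at least two generators on each
side, then π(w) ∪ π(w') has at most 2d elements and extends inside M to some Z of size 2d.
Completing w and w' to products wa and w'a' over Z gives a quadratic relation, and a common tail T
reduces both words to shorter ones by induction. -/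

namespace YBVeronese

/-! ### The bijective cocycle and the structure of the monoid of classes -/

section Cocycle

variable {X : Type*} {r : X × X → X × X}

/-- The permutation `y ↦ ˣy` of `X`. -/
noncomputable def leftPerm (hr : IsSolution r) (x : X) : Equiv.Perm X :=
  Equiv.ofBijective _ (hr.left_bijective x)

@[simp]
theorem leftPerm_apply (hr : IsSolution r) (x y : X) : leftPerm hr x y = (r (x, y)).1 := rfl

/-- This is the first coordinate of the braid relation; it makes the left action of words well
defined on classes. -/
theorem leftPerm_mul_leftPerm (hr : IsSolution r) (x y : X) :
    leftPerm hr (r (x, y)).1 * leftPerm hr (r (x, y)).2 = leftPerm hr x * leftPerm hr y := by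
  ext z
  have h := congrArg Prod.fst (congrFun hr.braid (x, y, z))
  simpa [r12, r23] using h

theorem leftPerm_fst_snd (hr : IsSolution r) (x y : X) :
    leftPerm hr (r (x, y)).1 (r (x, y)).2 = x := by
  simpa using congrArg Prod.fst (hr.involutive (x, y))

/-- The left action of words on letters. -/
noncomputable def wordPerm (hr : IsSolution r) : FreeMonoid X →* Equiv.Perm X :=
  FreeMonoid.lift (leftPerm hr)

/-- The bijective cocycle on lists, `π(x w) = {x} + ˣπ(w)`. -/
noncomputable def listCocycle (hr : IsSolution r) : List X → Multiset X
  | [] => 0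
  | x :: w => x ::ₘ (listCocycle hr w).map (leftPerm hr x)

/-- The bijective cocycle from words to the free commutative monoid, which identifies the words
of the same class. -/
noncomputable def cocycle (hr : IsSolution r) (w : FreeMonoid X) : Multiset X :=
  listCocycle hr w.toList

variable (hr : IsSolution r)

@[simp]
theorem cocycle_one : cocycle hr 1 = 0 := rfl

theorem cocycle_of_mul (x : X) (w : FreeMonoid X) :
    cocycle hr (FreeMonoid.of x * w) = x ::ₘ (cocycle hr w).map (leftPerm hr x) := rfl

@[simp]
theorem wordPerm_of (x : X) : wordPerm hr (FreeMonoid.of x) = leftPerm hr x := by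
  simp [wordPerm]

/-- The cocycle law: left factors of a word give submultisets of its value. -/
theorem cocycle_mul (u v : FreeMonoid X) :
    cocycle hr (u * v) = cocycle hr u + (cocycle hr v).map (wordPerm hr u) := by
  induction u using FreeMonoid.inductionOn' with
  | one => simp
  | of_mul x u ih =>
    rw [mul_assoc, cocycle_of_mul, ih, cocycle_of_mul]
    simp [Multiset.map_map, Function.comp_def]

theorem card_cocycle (u : FreeMonoid X) : Multiset.card (cocycle hr u) = u.length := by
  induction u using FreeMonoid.inductionOn' with
  | one => simp
  | of_mul x u ih => simp [cocycle_of_mul, ih, add_comm]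

theorem wordPerm_eq_of_ybCon {u v : FreeMonoid X} (h : ybCon r u v) :
    wordPerm hr u = wordPerm hr v := by
  have : ybCon r ≤ Con.ker (wordPerm hr) := by
    refine Con.conGen_le.2 ?_
    rintro w u ⟨x, y, rfl, rfl⟩
    simp [Con.ker_rel, leftPerm_mul_leftPerm]
  exact this h

/-- Both sides of a defining relation give {x, ˣy}, listed in opposite orders by involutivity.
Compatibility with products also needs the action to be constant on classes. -/
theorem cocycle_eq_of_ybCon {u v : FreeMonoid X} (h : ybCon r u v) :
    cocycle hr u = cocycle hr v := by
  induction h with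
  | of w u h =>
    obtain ⟨x, y, rfl, rfl⟩ := h
    have h2 (a b : X) : cocycle hr (FreeMonoid.of a * FreeMonoid.of b) = {a, leftPerm hr a b} := rfl
    rw [h2, h2, leftPerm_fst_snd, Multiset.pair_comm]
    rfl
  | refl => rfl
  | symm _ ih => exact ih.symm
  | trans _ _ ih1 ih2 => exact ih1.trans ih2
  | mul h1 _ ih1 ih2 => rw [cocycle_mul, cocycle_mul, ih1, ih2, wordPerm_eq_of_ybCon hr h1]

theorem ybCon_swap (x y : X) : ybCon r (FreeMonoid.of x * FreeMonoid.of y)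
    (FreeMonoid.of (r (x, y)).1 * FreeMonoid.of (r (x, y)).2) :=
  ConGen.Rel.of _ _ ⟨x, y, rfl, rfl⟩

/-- Any element of the multiset can be brought to the front: if z = ˣy, first bring y to the front
of the tail, then apply r to the pair xy. -/
theorem exists_ybCon_of_mul {u : FreeMonoid X} {z : X} (hz : z ∈ cocycle hr u) :
    ∃ v, ybCon r u (FreeMonoid.of z * v) := by
  induction u using FreeMonoid.inductionOn' generalizing z with
  | one => simp at hz
  | of_mul x u ih =>
    rw [cocycle_of_mul, Multiset.mem_cons] at hz
    obtain rfl | hz := hz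
    · exact ⟨u, (ybCon r).refl _⟩
    · obtain ⟨y, hy, rfl⟩ := Multiset.mem_map.1 hz
      obtain ⟨v, hv⟩ := ih hy
      refine ⟨FreeMonoid.of (r (x, y)).2 * v,
        (ybCon r).trans ((ybCon r).mul ((ybCon r).refl _) hv) ?_⟩
      rw [← mul_assoc, ← mul_assoc]
      exact (ybCon r).mul (ybCon_swap x y) ((ybCon r).refl _)

/-- Bring the first letter of one word to the front of the other, cancel it, and undo the twist by
its permutation. -/
theorem ybCon_of_cocycle_eq {u v : FreeMonoid X} (h : cocycle hr u = cocycle hr v) :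
    ybCon r u v := by
  induction u using FreeMonoid.inductionOn' generalizing v with
  | one =>
    have : v.length = 0 := by rw [← card_cocycle hr, ← h]; simp
    rw [FreeMonoid.length_eq_zero.1 this]
    exact (ybCon r).refl _
  | of_mul x u ih =>
    have hx : x ∈ cocycle hr v := by
      rw [← h, cocycle_of_mul]
      exact Multiset.mem_cons_self _ _
    obtain ⟨w, hw⟩ := exists_ybCon_of_mul hr hx
    rw [cocycle_eq_of_ybCon hr hw, cocycle_of_mul, cocycle_of_mul, Multiset.cons_inj_right] at h
    exact (ybCon r).trans ((ybCon r).mul ((ybCon r).refl _)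
      (ih (Multiset.map_injective (leftPerm hr x).injective h))) ((ybCon r).symm hw)

theorem ybCon_iff {u v : FreeMonoid X} : ybCon r u v ↔ cocycle hr u = cocycle hr v :=
  ⟨cocycle_eq_of_ybCon hr, ybCon_of_cocycle_eq hr⟩

theorem cocycle_surjective : Function.Surjective (cocycle hr) := by
  intro M
  induction h : Multiset.card M generalizing M with
  | zero => exact ⟨1, by simp [Multiset.card_eq_zero.1 h]⟩
  | succ m ih =>
    obtain ⟨x, hx⟩ := Multiset.exists_mem_of_ne_zero (s := M) (by rintro rfl; simp at h)
    obtain ⟨M', rfl⟩ := Multiset.exists_cons_of_mem hx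
    obtain ⟨u, hu⟩ := ih (M'.map (leftPerm hr x).symm) (by simpa using h)
    exact ⟨FreeMonoid.of x * u, by rw [cocycle_of_mul, hu]; simp [Multiset.map_map]⟩

/-- The converse half of the dictionary: inclusion of multisets is realised by left divisibility,
the quotient being the untwisted complement. -/
theorem exists_cocycle_mul {u : FreeMonoid X} {M : Multiset X} (h : cocycle hr u ≤ M) :
    ∃ v, cocycle hr (u * v) = M := by
  obtain ⟨M', rfl⟩ := Multiset.le_iff_exists_add.1 h
  obtain ⟨v, hv⟩ := cocycle_surjective hr (M'.map (wordPerm hr u).symm)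
  exact ⟨v, by rw [cocycle_mul, hv]; simp [Multiset.map_map]⟩

theorem ybCon_mul_left_cancel (hr : IsSolution r) {u v w : FreeMonoid X} (h : ybCon r (u * v) (u * w)) :
    ybCon r v w := by
  rw [ybCon_iff hr, cocycle_mul, cocycle_mul] at h
  exact ybCon_of_cocycle_eq hr (Multiset.map_injective (wordPerm hr u).injective
    (add_left_cancel h))

/-! ### The braiding on classes of words -/

/-- The recursion continues with c^y in place of c, and the identity for products of left
permutations absorbs this change. -/
theorem listCocycle_letterBraid (b : List X) (c : X) :
    listCocycle hr (letterBraid r c b).1 = (listCocycle hr b).map (leftPerm hr c) := by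
  induction b generalizing c with
  | nil => rfl
  | cons y b ih =>
    have h := leftPerm_mul_leftPerm hr c y
    simp only [letterBraid, listCocycle, ih, Multiset.map_cons, Multiset.map_map,
      ← Equiv.Perm.coe_mul, h]
    rfl

theorem ybCon_letterBraid (b : List X) (c : X) :
    ybCon r (FreeMonoid.ofList (letterBraid r c b).1 * FreeMonoid.of (letterBraid r c b).2)
      (FreeMonoid.of c * FreeMonoid.ofList b) := by
  induction b generalizing c with
  | nil => exact (ybCon r).refl _
  | cons y b ih =>
    simp only [letterBraid, FreeMonoid.ofList_cons]
    rw [mul_assoc, ← mul_assoc (FreeMonoid.of c)]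
    refine (ybCon r).trans ((ybCon r).mul ((ybCon r).refl _) (ih _)) ?_
    rw [← mul_assoc]
    exact (ybCon r).mul ((ybCon r).symm (ybCon_swap c y)) ((ybCon r).refl _)

theorem cocycle_leftAct (a b : FreeMonoid X) :
    cocycle hr (leftAct r a b) = (cocycle hr b).map (wordPerm hr a) := by
  induction a using FreeMonoid.inductionOn' with
  | one => simp only [map_one, Equiv.Perm.coe_one, Multiset.map_id]; rfl
  | of_mul x a ih =>
    rw [map_mul, Equiv.Perm.coe_mul, ← Multiset.map_map, ← ih, wordPerm_of]
    exact listCocycle_letterBraid hr _ x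

theorem ybCon_leftAct_mul_rightAct (a b : FreeMonoid X) :
    ybCon r (leftAct r a b * rightAct r a b) (a * b) := by
  induction a using FreeMonoid.inductionOn' with
  | one =>
    have h : leftAct r 1 b * rightAct r 1 b = 1 * b := by
      rw [one_mul]
      exact mul_one b
    exact h ▸ (ybCon r).refl _
  | of_mul x a ih =>
    have h1 := ybCon_letterBraid (r := r) (leftAct r a b).toList x
    have h2 := (ybCon r).mul h1 ((ybCon r).refl (rightAct r a b))
    have h3 := (ybCon r).mul ((ybCon r).refl (FreeMonoid.of x)) ih
    rw [FreeMonoid.ofList_toList, mul_assoc, mul_assoc] at h2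
    rw [mul_assoc]
    exact (ybCon r).trans h2 h3

end Cocycle

/-! ### The ideal of relations and normal words -/

section Normal

/-- An ideal of a monoid algebra that identifies the elements with the same value of `φ` contains
all elements whose coefficients sum up to zero over each fibre of `φ`. -/
theorem mem_of_mapDomain_eq_zero {k M N : Type*} [Field k] [Monoid M]
    (J : TwoSidedIdeal (MonoidAlgebra k M)) (φ : M → N)
    (h : ∀ a b, φ a = φ b → MonoidAlgebra.of k M a - MonoidAlgebra.of k M b ∈ J)
    {f : MonoidAlgebra k M} (hf : f.coeff.mapDomain φ = 0) : f ∈ J := by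
  have hJ (c : k) {f : MonoidAlgebra k M} (hf : f ∈ J) : c • f ∈ J := by
    rw [Algebra.smul_def]
    exact J.mul_mem_left _ _ hf
  -- Moving each basis element to a chosen representative of its fibre changes f only by an element
  -- of J, and the result depends only on the fibre sums.
  have key (f : MonoidAlgebra k M) :
      f - f.mapDomain (fun a => Function.invFun φ (φ a)) ∈ J := by
    induction f using MonoidAlgebra.induction_linear with
    | zero => simp
    | add f g hf hg =>
      rw [MonoidAlgebra.mapDomain_add, add_sub_add_comm]
      exact J.add_mem hf hg
    | single a c =>
      have := hJ c (h a (Function.invFun φ (φ a)) (Function.invFun_eq ⟨a, rfl⟩).symm)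
      simpa [smul_sub, MonoidAlgebra.smul_single] using this
  have h0 : f.mapDomain (fun a => Function.invFun φ (φ a)) = 0 := by
    apply MonoidAlgebra.coeff_injective
    change f.coeff.mapDomain (Function.invFun φ ∘ φ) = 0
    rw [Finsupp.mapDomain_comp, hf, Finsupp.mapDomain_zero]
  simpa [h0] using key f

variable {k X : Type*} [Field k] {r : X × X → X × X}

/-- The ideal dies in the monoid algebra of classes, through which π factors; conversely, words with
equal π are congruent, so their differences lie in the ideal. -/
theorem mem_ybIdeal_iff (hr : IsSolution r) {f : Free k X} :
    f ∈ ybIdeal k r ↔ f.coeff.mapDomain (cocycle hr) = 0 := by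
  constructor
  · intro hf
    let π : Free k X →+* MonoidAlgebra k (ybCon r).Quotient :=
      MonoidAlgebra.mapDomainRingHom k (ybCon r).mk'
    have hπ : ybIdeal k r ≤ TwoSidedIdeal.ker π := by
      refine TwoSidedIdeal.span_le.2 ?_
      rintro _ ⟨x, y, y', x', h, -, rfl⟩
      have hc : (ybCon r).mk' (FreeMonoid.of x * FreeMonoid.of y)
          = (ybCon r).mk' (FreeMonoid.of y' * FreeMonoid.of x') :=
        (Con.eq _).2 (ConGen.Rel.of _ _ ⟨x, y, rfl, by rw [h]⟩)
      simp only [SetLike.mem_coe, TwoSidedIdeal.mem_ker, map_sub, π, mon, MonoidAlgebra.of_apply,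
        MonoidAlgebra.mapDomainRingHom_apply, MonoidAlgebra.mapDomain_single]
      rw [hc, sub_self]
    have h0 : (π f).coeff = 0 := by rw [(TwoSidedIdeal.mem_ker _).1 (hπ hf)]; rfl
    have h1 : f.coeff.mapDomain (ybCon r).mk' = 0 := h0
    let φ : (ybCon r).Quotient → Multiset X := fun q =>
      Quotient.liftOn q (cocycle hr) fun _ _ => cocycle_eq_of_ybCon hr
    have h2 : cocycle hr = φ ∘ (ybCon r).mk' := rfl
    rw [h2, Finsupp.mapDomain_comp, h1, Finsupp.mapDomain_zero]
  · refine mem_of_mapDomain_eq_zero _ _ fun a b h => ?_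
    exact wordCon_iff.1 (ybCon_le k r (ybCon_of_cocycle_eq hr h))

theorem coeff_mon {Y : Type*} (w : FreeMonoid Y) : (mon k w).coeff = Finsupp.single w 1 := rfl

theorem mon_sub_mon_mem_iff (hr : IsSolution r) {u v : FreeMonoid X} :
    mon k u - mon k v ∈ ybIdeal k r ↔ cocycle hr u = cocycle hr v := by
  rw [mem_ybIdeal_iff hr, MonoidAlgebra.coeff_sub, coeff_mon, coeff_mon, Finsupp.mapDomain_sub,
    Finsupp.mapDomain_single, Finsupp.mapDomain_single, sub_eq_zero,
    Finsupp.single_left_inj one_ne_zero]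

theorem isLM_mon_sub_mon [LinearOrder X] {u v : FreeMonoid X} (h : DegLex v u) :
    IsLM (mon k u - mon k v) u := by
  classical
  have hne : u ≠ v := by
    rintro rfl
    exact lt_irrefl _ ((degLex_iff _ _).1 h)
  have e (w : FreeMonoid X) : (mon k u - mon k v).coeff w
      = (if u = w then 1 else 0) - (if v = w then 1 else 0) := by
    rw [MonoidAlgebra.coeff_sub, coeff_mon, coeff_mon, Finsupp.sub_apply, Finsupp.single_apply,
      Finsupp.single_apply]
  refine ⟨by simp [hne.symm], fun w hw hwu => ?_⟩
  rw [e, if_neg (Ne.symm hwu)] at hw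
  obtain rfl : v = w := by
    by_contra hvw
    simp [hvw] at hw
  exact h

section

variable [LinearOrder X]

theorem IsNormal.of_mul_left {I : TwoSidedIdeal (Free k X)} {u v : FreeMonoid X}
    (h : IsNormal I (u * v)) : IsNormal I u :=
  fun f hf w hw a b e => h f hf w hw a (b * v) (by rw [e, mul_assoc])

theorem IsNormal.of_mul_right {I : TwoSidedIdeal (Free k X)} {u v : FreeMonoid X}
    (h : IsNormal I (u * v)) : IsNormal I v :=
  fun f hf w hw a b e => h f hf w hw (u * a) b (by rw [e]; simp only [mul_assoc])

/-- A normal word is the smallest word of its class. -/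
theorem IsNormal.key_le {u v : FreeMonoid X} (hu : IsNormal (ybIdeal k r) u) (h : ybCon r u v) :
    key u ≤ key v := by
  by_contra! hlt
  exact hu _ (wordCon_iff.1 (ybCon_le k r h)) u (isLM_mon_sub_mon ((degLex_iff _ _).2 hlt)) 1 1
    (by simp)

theorem IsNormal.eq_of_ybCon {u v : FreeMonoid X} (hu : IsNormal (ybIdeal k r) u)
    (hv : IsNormal (ybIdeal k r) v) (h : ybCon r u v) : u = v :=
  key_injective (le_antisymm (hu.key_le h) (hv.key_le ((ybCon r).symm h)))

variable [Fintype X]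

theorem cocycle_norWord (hr : IsSolution r) (w : FreeMonoid X) :
    cocycle hr (norWord k r w) = cocycle hr w :=
  ((mon_sub_mon_mem_iff hr).1 (norWord_spec k r w).2.2).symm

theorem ybCon_norWord (hr : IsSolution r) (w : FreeMonoid X) : ybCon r (norWord k r w) w :=
  ybCon_of_cocycle_eq hr (cocycle_norWord hr w)

/-- The class of a normal word of length `m`, as a multiset of size `m`. -/
noncomputable def normalCocycle (hr : IsSolution r) (m : ℕ) (u : NormalWord k r m) : Sym X m :=
  ⟨cocycle hr u.1, by rw [card_cocycle, u.2.2]⟩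

/-- Each class contains exactly one normal word, its minimum, and classes of length m correspond to
multisets of size m. -/
theorem normalCocycle_bijective (hr : IsSolution r) (m : ℕ) :
    Function.Bijective (normalCocycle (k := k) hr m) := by
  constructor
  · intro u v h
    exact Subtype.ext (u.2.1.eq_of_ybCon v.2.1 (ybCon_of_cocycle_eq hr (congrArg Subtype.val h)))
  · rintro ⟨M, hM⟩
    obtain ⟨w, rfl⟩ := cocycle_surjective hr M
    refine ⟨⟨norWord k r w, (norWord_spec k r w).2.1, ?_⟩, Subtype.ext (cocycle_norWord hr w)⟩
    rw [(norWord_spec k r w).1, ← card_cocycle hr, hM]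

theorem card_normalWord (hr : IsSolution r) (m : ℕ) :
    Nat.card (NormalWord k r m) = (Fintype.card X + m - 1).choose m := by
  rw [Nat.card_congr (Equiv.ofBijective _ (normalCocycle_bijective hr m)), Nat.card_eq_fintype_card,
    Sym.card_sym_eq_choose]

theorem finite_normalWord (k : Type*) [Field k] (hr : IsSolution r) (m : ℕ) :
    Finite (NormalWord k r m) :=
  Finite.of_injective _ (normalCocycle_bijective hr m).1

theorem NormalWord.ext_cocycle (hr : IsSolution r) {m : ℕ} {u v : NormalWord k r m}
    (h : cocycle hr u.1 = cocycle hr v.1) : u = v :=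
  (normalCocycle_bijective hr m).1 (Subtype.ext h)

theorem exists_normalWord (k : Type*) [Field k] (hr : IsSolution r) {m : ℕ} {M : Multiset X}
    (h : Multiset.card M = m) : ∃ u : NormalWord k r m, cocycle hr u.1 = M := by
  obtain ⟨u, hu⟩ := (normalCocycle_bijective (k := k) hr m).2 ⟨M, h⟩
  exact ⟨u, congrArg Subtype.val hu⟩

end

end Normal

/-! ### The solution `ρ` and the index sets -/

section Pairs

/-- The comparison is already decided in the prefixes, so the tails may be arbitrary of equal
length. -/
theorem DegLex.mul_of_length_eq {X : Type*} [LinearOrder X] {u v : FreeMonoid X}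
    (h : DegLex u v) (hl : u.length = v.length) {a b : FreeMonoid X} (hab : a.length = b.length) :
    DegLex (u * a) (v * b) := by
  unfold DegLex at *
  have hl' : u.toList.length = v.toList.length := hl
  have hab' : a.toList.length = b.toList.length := hab
  rw [List.shortlex_iff_lex hl'] at h
  simp only [FreeMonoid.toList_mul]
  rw [List.shortlex_iff_lex (by simp [hl', hab'])]
  clear hl
  generalize u.toList = s at *
  generalize v.toList = t at *
  induction h with
  | nil => simp at hl'
  | cons h ih => exact List.Lex.cons (ih (by simpa using hl'))
  | rel h => exact List.Lex.rel h

variable {k X : Type*} [Field k] [LinearOrder X] {r : X × X → X × X} {d : ℕ}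

theorem length_concat (p : NormalWord k r d × NormalWord k r d) : (concat p).length = 2 * d := by
  rw [concat, FreeMonoid.length_mul, p.1.2.2, p.2.2.2, two_mul]

theorem concat_injective :
    Function.Injective (concat : NormalWord k r d × NormalWord k r d → FreeMonoid X) := by
  intro p q h
  have h1 : p.1.1.toList ++ p.2.1.toList = q.1.1.toList ++ q.2.1.toList := h
  obtain ⟨h2, h3⟩ := List.append_inj h1 (p.1.2.2.trans q.1.2.2.symm)
  exact Prod.ext (Subtype.ext h2) (Subtype.ext h3)

/-- Both halves of a normal word are subwords of it, hence normal. -/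
theorem exists_concat_eq {u : FreeMonoid X} (hu : IsNormal (ybIdeal k r) u)
    (hl : u.length = 2 * d) : ∃ q : NormalWord k r d × NormalWord k r d, concat q = u := by
  have e : FreeMonoid.ofList (u.toList.take d) * FreeMonoid.ofList (u.toList.drop d) = u :=
    List.take_append_drop d u.toList
  have hl' : u.toList.length = 2 * d := hl
  rw [← e] at hu
  refine ⟨(⟨_, hu.of_mul_left, ?_⟩, ⟨_, hu.of_mul_right, ?_⟩), e⟩
  · change (u.toList.take d).length = d
    rw [List.length_take]; omega
  · change (u.toList.drop d).length = d
    rw [List.length_drop]; omega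

theorem degLex_asymm {u v : FreeMonoid X} (h : DegLex u v) : ¬ DegLex v u := by
  rw [degLex_iff] at *
  exact h.asymm

variable [Fintype X]

theorem cocycle_rho_fst (hr : IsSolution r) (p : NormalWord k r d × NormalWord k r d) :
    cocycle hr (rho k r d p).1.1 = (cocycle hr p.2.1).map (wordPerm hr p.1.1) :=
  (cocycle_norWord hr _).trans (cocycle_leftAct hr _ _)

theorem ybCon_concat_rho (hr : IsSolution r) (p : NormalWord k r d × NormalWord k r d) :
    ybCon r (concat (rho k r d p)) (concat p) :=
  (ybCon r).trans ((ybCon r).mul (ybCon_norWord hr _) (ybCon_norWord hr _))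
    (ybCon_leftAct_mul_rightAct _ _)

/-- Left cancellation reduces statements about ρ to statements about first entries. -/
theorem eq_of_fst_eq_of_ybCon (hr : IsSolution r) {p q : NormalWord k r d × NormalWord k r d}
    (h1 : p.1 = q.1) (h : ybCon r (concat p) (concat q)) : p = q := by
  refine Prod.ext h1 (NormalWord.ext_cocycle hr (cocycle_eq_of_ybCon hr ?_))
  rw [concat, concat, h1] at h
  exact ybCon_mul_left_cancel hr h

theorem rho_involutive (hr : IsSolution r) : Function.Involutive (rho k r d) := by
  intro p
  have h := ybCon_concat_rho hr p
  refine eq_of_fst_eq_of_ybCon hr (NormalWord.ext_cocycle hr ?_)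
    ((ybCon r).trans (ybCon_concat_rho hr _) h)
  -- With ρ(a,b) = (a',b') and a'' the first entry of ρ(a',b'), this reads π(a') + π(a'') = π(a) +
  -- π(a'), because ᵃπ(b) = π(a').
  have h1 := cocycle_eq_of_ybCon hr h
  rw [concat, concat, cocycle_mul, cocycle_mul, ← cocycle_rho_fst, ← cocycle_rho_fst,
    add_comm] at h1
  exact add_right_cancel h1

theorem rho_eq_self_of_fst (hr : IsSolution r) {p : NormalWord k r d × NormalWord k r d}
    (h : (rho k r d p).1 = p.1) : rho k r d p = p :=
  eq_of_fst_eq_of_ybCon hr h (ybCon_concat_rho hr p)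

theorem existsUnique_rho_eq_self (hr : IsSolution r) (a : NormalWord k r d) :
    ∃! b, rho k r d (a, b) = (a, b) := by
  -- The pair (a,b) is fixed iff ᵃπ(b) = π(a), which forces this multiset for b.
  obtain ⟨b, hb⟩ := exists_normalWord k hr (m := d)
    (M := (cocycle hr a.1).map (wordPerm hr a.1).symm) (by simp [card_cocycle, a.2.2])
  refine ⟨b, rho_eq_self_of_fst hr (NormalWord.ext_cocycle hr ?_), fun c hc => ?_⟩
  · rw [cocycle_rho_fst, hb]
    simp [Multiset.map_map]
  · refine NormalWord.ext_cocycle hr (Multiset.map_injective (wordPerm hr a.1).injective ?_)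
    rw [hb, ← cocycle_rho_fst hr (a, c), hc]
    simp [Multiset.map_map]

theorem degLex_concat_of_mem_setH {p : NormalWord k r d × NormalWord k r d}
    (hp : p ∈ setH k r d) : DegLex (concat (rho k r d p)) (concat p) :=
  DegLex.mul_of_length_eq hp ((rho k r d p).1.2.2.trans p.1.2.2.symm)
    ((rho k r d p).2.2.2.trans p.2.2.2.symm)

/-- On a nontrivial orbit the two first entries differ, and passing from p to ρ(p) reverses their
comparison. -/
theorem xor_mem_setH (hr : IsSolution r) {p : NormalWord k r d × NormalWord k r d}
    (hp : rho k r d p ≠ p) : Xor (p ∈ setH k r d) (rho k r d p ∈ setH k r d) := by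
  have hne : key (rho k r d p).1.1 ≠ key p.1.1 := fun h =>
    hp (rho_eq_self_of_fst hr (Subtype.ext (key_injective h)))
  simp only [setH, Set.mem_ofPred_eq, rho_involutive hr p, degLex_iff]
  obtain h | h := hne.lt_or_gt
  · exact Or.inl ⟨h, h.asymm⟩
  · exact Or.inr ⟨h, h.asymm⟩

theorem rho_ne_of_mem_setH {p : NormalWord k r d × NormalWord k r d} (hp : p ∈ setH k r d) :
    rho k r d p ≠ p := by
  intro h
  have hp' : DegLex (rho k r d p).1.1 p.1.1 := hp
  rw [h] at hp'
  exact degLex_asymm hp' hp'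

theorem mem_setP_iff (hr : IsSolution r) {p : NormalWord k r d × NormalWord k r d} :
    p ∈ setP k r d ↔ p ∉ setH k r d := by
  constructor
  · rintro (h | h) hp
    · exact degLex_asymm h (degLex_concat_of_mem_setH hp)
    · exact rho_ne_of_mem_setH hp (concat_injective h).symm
  · intro h
    by_cases hp : rho k r d p = p
    · exact Or.inr (by rw [hp])
    · obtain ⟨h1, -⟩ | ⟨h1, -⟩ := xor_mem_setH hr hp
      · exact absurd h1 h
      · have := degLex_concat_of_mem_setH h1
        rw [rho_involutive hr p] at this
        exact Or.inl this

/-- Membership in P is automatic: a normal product is least in its class, which also contains the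
product of ρ(p). -/
theorem mem_setC_iff (hr : IsSolution r) {p : NormalWord k r d × NormalWord k r d} :
    p ∈ setC k r d ↔ IsNormal (ybIdeal k r) (concat p) := by
  refine ⟨And.right, fun h => ⟨?_, h⟩⟩
  obtain h1 | h1 := (h.key_le ((ybCon r).symm (ybCon_concat_rho hr p))).lt_or_eq
  · exact Or.inl ((degLex_iff _ _).2 h1)
  · exact Or.inr (key_injective h1)

theorem existsUnique_mem_setC (hr : IsSolution r) (p : NormalWord k r d × NormalWord k r d) :
    ∃! q, q ∈ setC k r d ∧ concat q = norWord k r (concat p) := by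
  obtain ⟨h1, h2, -⟩ := norWord_spec k r (concat p)
  obtain ⟨q, hq⟩ := exists_concat_eq h2 (h1.trans (length_concat p))
  refine ⟨q, ⟨(mem_setC_iff hr).2 (hq ▸ h2), hq⟩, fun q' hq' => concat_injective ?_⟩
  rw [hq, hq'.2]

/-- A pair whose concatenation is not normal is bigger than its normal form. -/
theorem degLex_norWord (hr : IsSolution r) {u : FreeMonoid X} (hu : ¬ IsNormal (ybIdeal k r) u) :
    DegLex (norWord k r u) u := by
  have h := (norWord_spec k r u).2.1
  rw [degLex_iff]
  refine lt_of_le_of_ne (h.key_le (ybCon_norWord hr u)) fun e => hu ?_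
  rwa [← key_injective e]

theorem not_isNormal_of_mem_setH (hr : IsSolution r) {p : NormalWord k r d × NormalWord k r d}
    (hp : p ∈ setH k r d) : ¬ IsNormal (ybIdeal k r) (concat p) :=
  fun h => (mem_setP_iff hr).1 ((mem_setC_iff hr).2 h).1 hp

/-! ### Cardinalities of the index sets -/

theorem ncard_fixed (hr : IsSolution r) :
    {p | rho k r d p = p}.ncard = Nat.card (NormalWord k r d) := by
  rw [← Nat.card_coe_set_eq]
  refine Nat.card_congr (Equiv.ofBijective (fun p => p.1.1) ⟨?_, ?_⟩)
  · rintro ⟨⟨a, b⟩, hp⟩ ⟨⟨a', b'⟩, hq⟩ (rfl : a = a')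
    exact Subtype.ext (Prod.ext rfl ((existsUnique_rho_eq_self hr a).unique hp hq))
  · intro a
    obtain ⟨b, hb, -⟩ := existsUnique_rho_eq_self hr a
    exact ⟨⟨(a, b), hb⟩, rfl⟩

theorem setP_eq (hr : IsSolution r) :
    setP k r d = {p | rho k r d p = p} ∪ rho k r d '' setH k r d := by
  ext p
  rw [mem_setP_iff hr, Set.mem_union, Set.mem_ofPred_eq]
  constructor
  · intro h
    by_cases hp : rho k r d p = p
    · exact Or.inl hp
    · obtain ⟨h1, -⟩ | ⟨h1, -⟩ := xor_mem_setH hr hp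
      · exact absurd h1 h
      · exact Or.inr ⟨_, h1, rho_involutive hr p⟩
  · rintro (h | ⟨q, hq, rfl⟩) hp
    · exact rho_ne_of_mem_setH hp h
    · obtain ⟨-, h1⟩ | ⟨-, h1⟩ := xor_mem_setH hr (rho_ne_of_mem_setH hq)
      · exact h1 hp
      · exact h1 hq

theorem ncard_setP (hr : IsSolution r) :
    (setP k r d).ncard = Nat.card (NormalWord k r d) + (setH k r d).ncard := by
  have := finite_normalWord k hr d
  rw [setP_eq hr, Set.ncard_union_eq ?_ (Set.toFinite _) (Set.toFinite _), ncard_fixed hr,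
    Set.ncard_image_of_injective _ (rho_involutive hr).injective]
  rw [Set.disjoint_left]
  rintro _ h ⟨q, hq, rfl⟩
  exact rho_ne_of_mem_setH hq (rho_involutive hr |>.injective h)

/-- Here P is the complement of H and consists of the N fixed pairs and a copy of H, so N² = N +
2|H|. -/
theorem ncard_setH (hr : IsSolution r) :
    (setH k r d).ncard = (Nat.card (NormalWord k r d)).choose 2 := by
  have := finite_normalWord k hr d
  have h1 : setP k r d = (setH k r d)ᶜ := Set.ext fun p => mem_setP_iff hr
  have h2 := Set.ncard_add_ncard_compl (setH k r d)
  rw [← h1, ncard_setP hr, Nat.card_prod] at h2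
  generalize Nat.card (NormalWord k r d) = N at *
  cases N with
  | zero => simp at h2 ⊢; omega
  | succ N =>
    rw [Nat.choose_two_right, Nat.add_sub_cancel]
    refine (Nat.div_eq_of_eq_mul_left two_pos ?_).symm
    linarith

theorem ncard_setC (hr : IsSolution r) :
    (setC k r d).ncard = Nat.card (NormalWord k r (2 * d)) := by
  rw [← Nat.card_coe_set_eq]
  refine Nat.card_congr (Equiv.ofBijective
    (fun p => ⟨concat p.1, p.2.2, length_concat p.1⟩) ⟨?_, ?_⟩)
  · intro p q h
    exact Subtype.ext (concat_injective (congrArg Subtype.val h))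
  · intro u
    obtain ⟨q, hq⟩ := exists_concat_eq u.2.1 u.2.2
    exact ⟨⟨q, (mem_setC_iff hr).2 (hq ▸ u.2.1)⟩, Subtype.ext hq⟩

theorem ncard_setMV_add (hr : IsSolution r) :
    (setMV k r d).ncard + Nat.card (NormalWord k r (2 * d))
      = (Nat.card (NormalWord k r d) + 1).choose 2 := by
  have := finite_normalWord k hr d
  have h : setMV k r d ∪ setC k r d = setP k r d := by
    ext p
    simp only [setMV, setC, Set.mem_union, Set.mem_ofPred_eq, ← and_or_left]
    exact and_iff_left (em' _)
  rw [← ncard_setC hr, ← Set.ncard_union_eq ?_ (Set.toFinite _) (Set.toFinite _), h, ncard_setP hr,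
    ncard_setH hr, Nat.choose_succ_succ' _ 1, Nat.choose_one_right]
  exact Set.disjoint_left.2 fun p hp hq => hp.2 hq.2

end Pairs

/-! ### Leading monomials and linear independence -/

section LeadingMonomials

variable {k X : Type*} [Field k] [LinearOrder X]

theorem IsLM.unique {f : Free k X} {u v : FreeMonoid X} (hu : IsLM f u) (hv : IsLM f v) :
    u = v := by
  by_contra h
  exact degLex_asymm (hu.2 v hv.1 (Ne.symm h)) (hv.2 u hu.1 h)

/-- Polynomials with distinct leading monomials are linearly independent. -/
theorem linearIndependent_of_isLM {ι : Type*} {f : ι → Free k X} {u : ι → FreeMonoid X}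
    (hu : Function.Injective u) (h : ∀ i, IsLM (f i) (u i)) : LinearIndependent k f := by
  classical
  rw [linearIndependent_iff']
  intro s c hsum
  by_contra! hcon
  obtain ⟨i, hi, hci⟩ := hcon
  -- The largest leading monomial among the terms with nonzero coefficient occurs in no other such
  -- term, so it cannot cancel.
  obtain ⟨j, hj, hmax⟩ := Finset.exists_max_image (s.filter fun i => c i ≠ 0) (fun i => key (u i))
    ⟨i, Finset.mem_filter.2 ⟨hi, hci⟩⟩
  rw [Finset.mem_filter] at hj
  have h1 : (∑ i ∈ s, c i • f i).coeff (u j) = c j * (f j).coeff (u j) := by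
    rw [MonoidAlgebra.coeff_sum, Finsupp.finsetSum_apply, Finset.sum_eq_single j]
    · simp
    · intro b hb hbj
      rw [MonoidAlgebra.coeff_smul_apply, smul_eq_mul]
      by_contra hne
      obtain ⟨h2, h3⟩ := mul_ne_zero_iff.1 hne
      have h4 := (degLex_iff _ _).1 ((h b).2 (u j) h3 (fun e => hbj (hu e).symm))
      exact absurd h4 (not_lt.2 (hmax b (Finset.mem_filter.2 ⟨hb, h2⟩)))
    · exact fun h => absurd hj.1 h
  rw [hsum] at h1
  exact mul_ne_zero hj.2 (h j).1 h1.symm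

end LeadingMonomials

/-! ### The sets of relations -/

section Relations

variable {k X : Type*} [Field k] [LinearOrder X] {r : X × X → X × X} {d : ℕ}

theorem evalHom_mon {Y A : Type*} [Ring A] [Algebra k A] (gen : Y → A) (w : FreeMonoid Y) :
    evalHom gen (mon k w) = FreeMonoid.lift gen w :=
  MonoidAlgebra.lift_of _ _

theorem expand_binomial (p q : NormalWord k r d × NormalWord k r d) :
    expand k r d (binomial k p q) = mon k (concat p) - mon k (concat q) := by
  rw [expand, binomial, map_sub, evalHom_mon, evalHom_mon]
  simp [pairWord, concat, -MonoidAlgebra.of_apply]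

theorem binomial_self (p : NormalWord k r d × NormalWord k r d) : binomial k p p = 0 :=
  sub_self _

theorem binomial_sub_binomial (p q s : NormalWord k r d × NormalWord k r d) :
    binomial k p s - binomial k q s = binomial k p q :=
  sub_sub_sub_cancel_right _ _ _

theorem isLM_expand_binomial {p q : NormalWord k r d × NormalWord k r d}
    (h : DegLex (concat q) (concat p)) : IsLM (expand k r d (binomial k p q)) (concat p) := by
  rw [expand_binomial]
  exact isLM_mon_sub_mon h

/-- The leading monomial of the expansion recovers the indexing pair. -/
theorem eq_of_binomial_eq {p q p' q' : NormalWord k r d × NormalWord k r d}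
    (h : DegLex (concat q) (concat p)) (h' : DegLex (concat q') (concat p'))
    (e : binomial k p q = binomial k p' q') : p = p' :=
  concat_injective ((isLM_expand_binomial h).unique (e ▸ isLM_expand_binomial h'))

section

variable {S : Set (NormalWord k r d × NormalWord k r d)}
  {φ : NormalWord k r d × NormalWord k r d → NormalWord k r d × NormalWord k r d}

theorem ncard_image_binomial (h : ∀ p ∈ S, DegLex (concat (φ p)) (concat p)) :
    ((fun p => binomial k p (φ p)) '' S).ncard = S.ncard :=
  Set.InjOn.ncard_image fun p hp q hq e => eq_of_binomial_eq (h p hp) (h q hq) e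

theorem linearIndependent_expand_image_binomial
    (h : ∀ p ∈ S, DegLex (concat (φ p)) (concat p)) :
    LinearIndependent k (fun g : ↥((fun p => binomial k p (φ p)) '' S) => expand k r d g.1) := by
  refine linearIndependent_of_isLM (u := fun g => concat g.2.choose) (fun g g' e => ?_) fun g => ?_
  · refine Subtype.ext ?_
    rw [← g.2.choose_spec.2, ← g'.2.choose_spec.2, concat_injective e]
  · have h1 := isLM_expand_binomial (h _ g.2.choose_spec.1)
    rwa [show binomial k _ _ = g.1 from g.2.choose_spec.2] at h1

theorem linearIndependent_of_expand {T : Set (Free k (NormalWord k r d))}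
    (h : LinearIndependent k (fun g : ↥T => expand k r d g.1)) :
    LinearIndependent k (fun g : ↥T => g.1) :=
  LinearIndependent.of_comp (expand k r d).toLinearMap h

end

variable [Fintype X]

/-- The pair of normal words whose concatenation is the normal form of the concatenation of `p`. -/
noncomputable def normalPair (hr : IsSolution r) (p : NormalWord k r d × NormalWord k r d) :
    NormalWord k r d × NormalWord k r d :=
  (existsUnique_mem_setC hr p).choose

theorem normalPair_mem (hr : IsSolution r) (p : NormalWord k r d × NormalWord k r d) :
    normalPair hr p ∈ setC k r d :=
  (existsUnique_mem_setC hr p).choose_spec.1.1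

theorem concat_normalPair (hr : IsSolution r) (p : NormalWord k r d × NormalWord k r d) :
    concat (normalPair hr p) = norWord k r (concat p) :=
  (existsUnique_mem_setC hr p).choose_spec.1.2

theorem normalPair_eq_of_ybCon (hr : IsSolution r) {p q : NormalWord k r d × NormalWord k r d}
    (h : ybCon r (concat p) (concat q)) : normalPair hr p = normalPair hr q := by
  apply concat_injective
  rw [concat_normalPair, concat_normalPair]
  exact (norWord_spec k r _).2.1.eq_of_ybCon (norWord_spec k r _).2.1
    ((ybCon r).trans (ybCon_norWord hr _) ((ybCon r).trans h ((ybCon r).symm (ybCon_norWord hr _))))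

theorem degLex_of_concat_eq_norWord (hr : IsSolution r)
    {p q : NormalWord k r d × NormalWord k r d} (hp : p ∈ setH k r d ∪ setMV k r d)
    (h : concat q = norWord k r (concat p)) : DegLex (concat q) (concat p) := by
  rw [h]
  exact degLex_norWord hr (hp.elim (not_isNormal_of_mem_setH hr) And.right)

theorem degLex_normalPair (hr : IsSolution r) {p : NormalWord k r d × NormalWord k r d}
    (hp : p ∈ setH k r d ∪ setMV k r d) : DegLex (concat (normalPair hr p)) (concat p) :=
  degLex_of_concat_eq_norWord hr hp (concat_normalPair hr p)

theorem disjoint_setH_setMV (hr : IsSolution r) : Disjoint (setH k r d) (setMV k r d) :=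
  Set.disjoint_left.2 fun _ hp hq => (mem_setP_iff hr).1 hq.1 hp

theorem relA_eq : relA k r d = (fun p => binomial k p (rho k r d p)) '' setH k r d := by
  ext g
  simp only [relA, Set.mem_ofPred_eq, Set.mem_image, eq_comm]

theorem image_normalPair (hr : IsSolution r) (S : Set (NormalWord k r d × NormalWord k r d)) :
    {g | ∃ p ∈ S, ∃ q ∈ setC k r d, concat q = norWord k r (concat p) ∧ g = binomial k p q}
      = (fun p => binomial k p (normalPair hr p)) '' S := by
  ext g
  constructor
  · rintro ⟨p, hp, q, hq, h, rfl⟩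
    refine ⟨p, hp, ?_⟩
    dsimp only
    rw [(existsUnique_mem_setC hr p).unique ⟨hq, h⟩ ⟨normalPair_mem hr p, concat_normalPair hr p⟩]
  · rintro ⟨p, hp, rfl⟩
    exact ⟨p, hp, _, normalPair_mem hr p, concat_normalPair hr p, rfl⟩

theorem relB_eq (hr : IsSolution r) :
    relB k r d = (fun p => binomial k p (normalPair hr p)) '' setMV k r d :=
  image_normalPair hr _

theorem relA'_eq (hr : IsSolution r) :
    relA' k r d = (fun p => binomial k p (normalPair hr p)) '' setH k r d :=
  image_normalPair hr _

theorem relA'_union_relB_eq (hr : IsSolution r) : relA' k r d ∪ relB k r d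
    = (fun p => binomial k p (normalPair hr p)) '' (setH k r d ∪ setMV k r d) := by
  rw [relA'_eq hr, relB_eq hr, Set.image_union]

open Classical in
/-- `ρ` on `H(n,d)`, and the normal form elsewhere. -/
noncomputable def reduction (hr : IsSolution r) (p : NormalWord k r d × NormalWord k r d) :
    NormalWord k r d × NormalWord k r d :=
  if p ∈ setH k r d then rho k r d p else normalPair hr p

theorem reduction_of_mem_setH (hr : IsSolution r) {p : NormalWord k r d × NormalWord k r d}
    (hp : p ∈ setH k r d) : reduction hr p = rho k r d p :=
  if_pos hp

theorem reduction_of_mem_setMV (hr : IsSolution r) {p : NormalWord k r d × NormalWord k r d}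
    (hp : p ∈ setMV k r d) : reduction hr p = normalPair hr p :=
  if_neg ((mem_setP_iff hr).1 hp.1)

/-- Writing the union as one family p - φ(p) with φ(p) smaller than p lets the leading monomial
argument treat it at once. -/
theorem relA_union_relB_eq (hr : IsSolution r) : relA k r d ∪ relB k r d
    = (fun p => binomial k p (reduction hr p)) '' (setH k r d ∪ setMV k r d) := by
  rw [relA_eq, relB_eq hr, Set.image_union]
  congr 1
  · exact Set.image_congr fun p hp => by rw [reduction_of_mem_setH hr hp]
  · exact Set.image_congr fun p hp => by rw [reduction_of_mem_setMV hr hp]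

theorem degLex_reduction (hr : IsSolution r) {p : NormalWord k r d × NormalWord k r d}
    (hp : p ∈ setH k r d ∪ setMV k r d) : DegLex (concat (reduction hr p)) (concat p) := by
  obtain h | h := hp
  · rw [reduction_of_mem_setH hr h]
    exact degLex_concat_of_mem_setH h
  · rw [reduction_of_mem_setMV hr h]
    exact degLex_normalPair hr (Or.inr h)

theorem disjoint_image_binomial (hr : IsSolution r)
    {φ : NormalWord k r d × NormalWord k r d → NormalWord k r d × NormalWord k r d}
    (h : ∀ p ∈ setH k r d, DegLex (concat (φ p)) (concat p)) :
    Disjoint ((fun p => binomial k p (φ p)) '' setH k r d) (relB k r d) := by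
  rw [relB_eq hr, Set.disjoint_left]
  rintro _ ⟨p, hp, rfl⟩ ⟨q, hq, e⟩
  refine Set.disjoint_left.1 (disjoint_setH_setMV hr) hp ?_
  rwa [eq_of_binomial_eq (h p hp) (degLex_normalPair hr (Or.inr hq)) e.symm]

theorem existsUnique_relA (hr : IsSolution r) {p : NormalWord k r d × NormalWord k r d}
    (hp : rho k r d p ≠ p) :
    ∃! g, g ∈ relA k r d ∧ g.coeff (pairWord p) ≠ 0 := by
  classical
  have hinj : Function.Injective
      (pairWord : NormalWord k r d × NormalWord k r d → FreeMonoid (NormalWord k r d)) := by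
    intro a b h
    have h' : [a.1, a.2] = [b.1, b.2] := h
    simp only [List.cons.injEq, and_true] at h'
    exact Prod.ext h'.1 h'.2
  have e (a b c : NormalWord k r d × NormalWord k r d) : (binomial k a b).coeff (pairWord c)
      = (if a = c then 1 else 0) - (if b = c then 1 else 0) := by
    rw [binomial, MonoidAlgebra.coeff_sub, coeff_mon, coeff_mon, Finsupp.sub_apply,
      Finsupp.single_apply, Finsupp.single_apply]
    simp only [hinj.eq_iff]
  -- A relation of R_a involves only the two members of one orbit; of these, only one indexes a
  -- relation.
  have huniq (a : NormalWord k r d × NormalWord k r d)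
      (h : (binomial k a (rho k r d a)).coeff (pairWord p) ≠ 0) : a = p ∨ a = rho k r d p := by
    by_contra! hcon
    refine h ?_
    rw [e, if_neg hcon.1, if_neg, sub_zero]
    exact fun h' => hcon.2 (by rw [← h', rho_involutive hr a])
  obtain ⟨h1, h2⟩ | ⟨h1, h2⟩ := xor_mem_setH hr hp
  · refine ⟨_, ⟨⟨p, h1, rfl⟩, by simp [e, hp]⟩, ?_⟩
    rintro _ ⟨⟨a, ha, rfl⟩, hc⟩
    obtain rfl | rfl := huniq a hc
    · rfl
    · exact absurd ha h2
  · refine ⟨_, ⟨⟨_, h1, rfl⟩, by simp [e, hp, rho_involutive hr p]⟩, ?_⟩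
    rintro _ ⟨⟨a, ha, rfl⟩, hc⟩
    obtain rfl | rfl := huniq a hc
    · exact absurd ha h2
    · rfl

/-! ### Equivalence of the two sets of relations -/

theorem binomial_normalPair_mem_of_mem_setP (hr : IsSolution r)
    {V : Submodule k (Free k (NormalWord k r d))} (hV : relB k r d ⊆ V)
    {p : NormalWord k r d × NormalWord k r d} (hp : p ∈ setP k r d) :
    binomial k p (normalPair hr p) ∈ V := by
  by_cases hn : IsNormal (ybIdeal k r) (concat p)
  · have : normalPair hr p = p := by
      apply concat_injective
      rw [concat_normalPair]
      exact (norWord_spec k r _).2.1.eq_of_ybCon hn (ybCon_norWord hr _)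
    rw [this, binomial_self]
    exact V.zero_mem
  · rw [relB_eq hr] at hV
    exact hV ⟨p, ⟨hp, hn⟩, rfl⟩

theorem rho_mem_setP (hr : IsSolution r) {p : NormalWord k r d × NormalWord k r d}
    (hp : p ∈ setH k r d) : rho k r d p ∈ setP k r d := by
  rw [setP_eq hr]
  exact Or.inr ⟨p, hp, rfl⟩

/-- The two binomials differ by ρ(p) - Nor(p). Since ρ(p) is in P and has the same normal form as p,
this is zero or an element of R_b. -/
theorem binomial_rho_mem_iff (hr : IsSolution r) {V : Submodule k (Free k (NormalWord k r d))}
    (hV : relB k r d ⊆ V) {p : NormalWord k r d × NormalWord k r d} (hp : p ∈ setH k r d) :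
    binomial k p (rho k r d p) ∈ V ↔ binomial k p (normalPair hr p) ∈ V := by
  have h := binomial_normalPair_mem_of_mem_setP hr hV (rho_mem_setP hr hp)
  rw [normalPair_eq_of_ybCon hr (ybCon_concat_rho hr p)] at h
  rw [← binomial_sub_binomial p (rho k r d p) (normalPair hr p)]
  exact V.sub_mem_iff_left h

theorem span_relA_union_relB (hr : IsSolution r) :
    Submodule.span k (relA k r d ∪ relB k r d) = Submodule.span k (relA' k r d ∪ relB k r d) := by
  apply le_antisymm <;>
  · refine Submodule.span_le.2 (Set.union_subset ?_ (Set.subset_union_right.trans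
      Submodule.subset_span))
    have hB {T : Set (Free k (NormalWord k r d))} :
        relB k r d ⊆ Submodule.span k (T ∪ relB k r d) :=
      Set.subset_union_right.trans Submodule.subset_span
    simp only [relA_eq, relA'_eq hr]
    rintro _ ⟨p, hp, rfl⟩
    first
    | exact (binomial_rho_mem_iff hr hB hp).2 (Submodule.subset_span (Or.inl ⟨p, hp, rfl⟩))
    | exact (binomial_rho_mem_iff hr hB hp).1 (Submodule.subset_span (Or.inl ⟨p, hp, rfl⟩))

/-- The two-sided ideal generated by a set, as a submodule. -/
def idealSubmodule {A : Type*} [Ring A] [Algebra k A] (J : TwoSidedIdeal A) : Submodule k A where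
  carrier := J
  add_mem' := J.add_mem
  zero_mem' := J.zero_mem
  smul_mem' c x hx := by
    rw [Algebra.smul_def]
    exact J.mul_mem_left _ _ hx

theorem span_le_of_submodule_span_le {A : Type*} [Ring A] [Algebra k A] {S T : Set A}
    (h : Submodule.span k S ≤ Submodule.span k T) :
    TwoSidedIdeal.span S ≤ TwoSidedIdeal.span T := by
  have h1 : Submodule.span k T ≤ idealSubmodule (TwoSidedIdeal.span T) :=
    Submodule.span_le.2 TwoSidedIdeal.subset_span
  exact TwoSidedIdeal.span_le.2 fun x hx => h1 (h (Submodule.subset_span hx))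

theorem idealSpan_relA_union_relB (hr : IsSolution r) :
    TwoSidedIdeal.span (relA k r d ∪ relB k r d)
      = TwoSidedIdeal.span (relA' k r d ∪ relB k r d) :=
  le_antisymm (span_le_of_submodule_span_le (span_relA_union_relB (k := k) hr).le)
    (span_le_of_submodule_span_le (span_relA_union_relB (k := k) hr).ge)

/-- Both pairs reduce to the same normal pair, and each reduction is a relation or zero. -/
theorem binomial_mem_span (hr : IsSolution r) {p q : NormalWord k r d × NormalWord k r d}
    (h : ybCon r (concat p) (concat q)) :
    binomial k p q ∈ Submodule.span k (relA' k r d ∪ relB k r d) := by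
  have hB : relB k r d ⊆ Submodule.span k (relA' k r d ∪ relB k r d) :=
    Set.subset_union_right.trans Submodule.subset_span
  have key (p : NormalWord k r d × NormalWord k r d) :
      binomial k p (normalPair hr p) ∈ Submodule.span k (relA' k r d ∪ relB k r d) := by
    by_cases hp : p ∈ setH k r d
    · refine Submodule.subset_span (Or.inl ?_)
      rw [relA'_eq hr]
      exact ⟨p, hp, rfl⟩
    · exact binomial_normalPair_mem_of_mem_setP hr hB ((mem_setP_iff hr).2 hp)
  have := Submodule.sub_mem _ (key p) (key q)
  rwa [normalPair_eq_of_ybCon hr h, binomial_sub_binomial] at this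

end Relations

/-! ### The presentation of the Veronese subalgebra -/

section Presentation

theorem exists_between_card_eq {α : Type*} {U M : Multiset α} {n : ℕ} (h : U ≤ M)
    (h1 : Multiset.card U ≤ n) (h2 : n ≤ Multiset.card M) :
    ∃ Z, U ≤ Z ∧ Z ≤ M ∧ Multiset.card Z = n := by
  obtain ⟨V, rfl⟩ := Multiset.le_iff_exists_add.1 h
  rw [Multiset.card_add] at h2
  obtain ⟨T, hT⟩ : ∃ T, T ∈ Multiset.powersetCard (n - Multiset.card U) V := by
    refine Multiset.card_pos_iff_exists_mem.1 ?_
    rw [Multiset.card_powersetCard]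
    exact Nat.choose_pos (by omega)
  rw [Multiset.mem_powersetCard] at hT
  exact ⟨U + T, Multiset.le_add_right _ _, add_le_add_right hT.1 _, by
    rw [Multiset.card_add, hT.2]; omega⟩

variable {k X : Type*} [Field k] {r : X × X → X × X} {d : ℕ}

theorem ybComp_eq_span (m : ℕ) : ybComp k r m
    = Submodule.span k ((fun w => ybMk k r (mon k w)) '' {w : FreeMonoid X | w.length = m}) := by
  rw [ybComp, homog, Submodule.map_span, Set.image_image]
  rfl

theorem mapDomain_cocycle_apply_eq_zero (hr : IsSolution r) {P : FreeMonoid X → Prop}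
    {f : Free k X} (hf : f ∈ Submodule.span k (mon k '' {w | P w})) {M : Multiset X}
    (h : ∀ w, P w → cocycle hr w ≠ M) : f.coeff.mapDomain (cocycle hr) M = 0 := by
  induction hf using Submodule.span_induction with
  | mem f hf =>
    obtain ⟨w, hw, rfl⟩ := hf
    rw [coeff_mon, Finsupp.mapDomain_single, Finsupp.single_eq_of_ne (h w hw).symm]
  | zero => simp
  | add f g _ _ hf hg => rw [MonoidAlgebra.coeff_add, Finsupp.mapDomain_add, Finsupp.add_apply,
      hf, hg, add_zero]
  | smul c f _ hf => rw [MonoidAlgebra.coeff_smul, Finsupp.mapDomain_smul, Finsupp.smul_apply,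
      hf, smul_zero]

/-- The size of π(w) is the length of w, so elements of different degrees have fibre sums supported
on multisets of different sizes. Positivity of d makes md determine m. -/
theorem iSupIndep_ybComp (hr : IsSolution r) (hd : 0 < d) :
    iSupIndep fun m => ybComp k r (m * d) := by
  rw [iSupIndep_def]
  intro i
  rw [Submodule.disjoint_def]
  intro a ha hb
  simp only [ybComp, ← Submodule.map_iSup] at ha hb
  obtain ⟨f, hf, rfl⟩ := ha
  obtain ⟨g, hg, hgf⟩ := hb
  have hle : ⨆ j, ⨆ (_ : j ≠ i), homog k X (j * d)
      ≤ Submodule.span k (mon k '' {w | w.length ≠ i * d}) := by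
    refine iSup₂_le fun j hj => Submodule.span_mono (Set.image_mono ?_)
    rintro w (hw : w.length = j * d) (hw' : w.length = i * d)
    exact hj (Nat.eq_of_mul_eq_mul_right hd (hw.symm.trans hw'))
  have hfg : f.coeff.mapDomain (cocycle hr) = g.coeff.mapDomain (cocycle hr) := by
    have h := (mem_ybIdeal_iff hr).1 (ybMk_eq_iff.1 hgf)
    rw [MonoidAlgebra.coeff_sub, Finsupp.mapDomain_sub, sub_eq_zero] at h
    exact h.symm
  have h0 : f.coeff.mapDomain (cocycle hr) = 0 := by
    ext M
    by_cases hM : Multiset.card M = i * d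
    · rw [hfg]
      refine mapDomain_cocycle_apply_eq_zero hr (hle hg) ?_
      rintro w hw rfl
      exact hw (by rw [← hM, card_cocycle])
    · refine mapDomain_cocycle_apply_eq_zero hr hf ?_
      rintro w hw rfl
      exact hM (by rw [card_cocycle]; exact hw)
  have h1 := ybMk_eq_iff.2 ((sub_zero f).symm ▸ (mem_ybIdeal_iff hr).2 h0)
  rw [map_zero] at h1
  exact h1

theorem iSup_homog (Y : Type*) : ⨆ m, homog k Y m = ⊤ := by
  refine eq_top_iff.2 fun f _ => ?_
  induction f using MonoidAlgebra.induction_linear with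
  | zero => exact Submodule.zero_mem _
  | add f g hf hg => exact Submodule.add_mem _ (hf trivial) (hg trivial)
  | single w c =>
    have h : MonoidAlgebra.single w c = c • mon k w := by simp [MonoidAlgebra.smul_single]
    rw [h]
    exact Submodule.smul_mem _ _ (Submodule.mem_iSup_of_mem w.length
      (Submodule.subset_span ⟨w, rfl, rfl⟩))

theorem binomial_mem_homog {Y : Type*} (p q : Y × Y) : binomial k p q ∈ homog k Y 2 :=
  Submodule.sub_mem _ (Submodule.subset_span ⟨_, rfl, rfl⟩) (Submodule.subset_span ⟨_, rfl, rfl⟩)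

variable [LinearOrder X]

/-- The word in `X` obtained from a word in the normal words of length `d`. -/
def flatten : FreeMonoid (NormalWord k r d) →* FreeMonoid X :=
  FreeMonoid.lift fun w => w.1

@[simp]
theorem flatten_of (w : NormalWord k r d) : flatten (FreeMonoid.of w) = w.1 := by
  simp [flatten]

theorem length_flatten (W : FreeMonoid (NormalWord k r d)) :
    (flatten W).length = W.length * d := by
  induction W using FreeMonoid.inductionOn' with
  | one => simp
  | of_mul w W ih => simp [ih, w.2.2, add_mul]

theorem expand_mon (W : FreeMonoid (NormalWord k r d)) :
    expand k r d (mon k W) = mon k (flatten W) := by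
  rw [expand, evalHom_mon]
  induction W using FreeMonoid.inductionOn' with
  | one => simp only [map_one]
  | of_mul w W ih => simp [ih, -MonoidAlgebra.of_apply]

theorem coeff_expand (f : Free k (NormalWord k r d)) :
    (expand k r d f).coeff = f.coeff.mapDomain flatten := by
  induction f using MonoidAlgebra.induction_linear with
  | zero => simp
  | add f g hf hg => rw [map_add, MonoidAlgebra.coeff_add, hf, hg, MonoidAlgebra.coeff_add,
      Finsupp.mapDomain_add]
  | single W c =>
    have h : MonoidAlgebra.single W c = c • mon k W := by simp [MonoidAlgebra.smul_single]
    rw [h, map_smul, expand_mon, MonoidAlgebra.coeff_smul, MonoidAlgebra.coeff_smul, coeff_mon,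
      coeff_mon, Finsupp.mapDomain_smul, Finsupp.mapDomain_single]

theorem evalHom_veroneseGen (f : Free k (NormalWord k r d)) :
    evalHom (veroneseGen k r d) f = ybMk k r (expand k r d f) := by
  have h : (evalHom (veroneseGen k r d) : Free k (NormalWord k r d) →ₐ[k] YBAlgebra k r)
      = (ybMk k r).comp (expand k r d) := by
    refine MonoidAlgebra.algHom_ext (fun W => ?_) (Subsingleton.elim _ _)
    change evalHom (veroneseGen k r d) (mon k W) = ybMk k r (expand k r d (mon k W))
    rw [expand_mon, evalHom_mon]
    induction W using FreeMonoid.inductionOn' with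
    | one => simp only [map_one]
    | of_mul w W ih => simp [ih, veroneseGen, -MonoidAlgebra.of_apply]
  rw [h, AlgHom.comp_apply]

theorem mem_ker_evalHom_iff (hr : IsSolution r) {f : Free k (NormalWord k r d)} :
    f ∈ TwoSidedIdeal.ker (evalHom (veroneseGen k r d) : Free k _ →ₐ[k] YBAlgebra k r) ↔
      f.coeff.mapDomain (cocycle hr ∘ flatten) = 0 := by
  rw [TwoSidedIdeal.mem_ker, evalHom_veroneseGen, ← map_zero (ybMk k r), ybMk_eq_iff, sub_zero,
    mem_ybIdeal_iff hr, coeff_expand, Finsupp.mapDomain_comp]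

variable [Fintype X]

/-- Split off any submultiset of size d as a normal word and recurse on the quotient; this gives
generation in degree one. -/
theorem exists_flatten (hr : IsSolution r) (m : ℕ) {M : Multiset X}
    (hM : Multiset.card M = m * d) :
    ∃ W : FreeMonoid (NormalWord k r d), W.length = m ∧ cocycle hr (flatten W) = M := by
  induction m generalizing M with
  | zero => exact ⟨1, rfl, by simp [Multiset.card_eq_zero.1 (hM.trans (zero_mul d))]⟩
  | succ m ih =>
    rw [add_mul, one_mul] at hM
    obtain ⟨Z, -, hZM, hZ⟩ := exists_between_card_eq (n := d) (Multiset.zero_le M) (by simp)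
      (by omega)
    obtain ⟨w, rfl⟩ := exists_normalWord k hr hZ
    obtain ⟨v, rfl⟩ := exists_cocycle_mul hr hZM
    rw [card_cocycle, FreeMonoid.length_mul, w.2.2] at hM
    obtain ⟨W, hW, hWv⟩ := ih (M := cocycle hr v) (by rw [card_cocycle]; omega)
    refine ⟨FreeMonoid.of w * W, by simp [hW, add_comm], ?_⟩
    rw [map_mul, flatten_of, cocycle_mul, cocycle_mul, hWv]

/-- Words in the normal words of length `d` that are equal in the Yang--Baxter algebra are
congruent modulo the quadratic relations. -/
theorem mon_sub_mon_mem_of_cocycle_eq (hr : IsSolution r)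
    {J : TwoSidedIdeal (Free k (NormalWord k r d))}
    (hJ : ∀ p q : NormalWord k r d × NormalWord k r d, ybCon r (concat p) (concat q) →
      binomial k p q ∈ J) (hd : 0 < d) (W W' : FreeMonoid (NormalWord k r d))
    (h : cocycle hr (flatten W) = cocycle hr (flatten W')) : mon k W - mon k W' ∈ J := by
  have hlen : W.length = W'.length := by
    have := congrArg Multiset.card h
    rw [card_cocycle, card_cocycle, length_flatten, length_flatten] at this
    exact Nat.eq_of_mul_eq_mul_right hd this
  induction hm : W.length generalizing W W' with
  | zero =>
    rw [FreeMonoid.length_eq_zero.1 hm, FreeMonoid.length_eq_zero.1 (hlen.symm.trans hm), sub_self]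
    exact J.zero_mem
  | succ m ih =>
    have hcons (V : FreeMonoid (NormalWord k r d)) (hV : V.length = m + 1) :
        ∃ w V', V = FreeMonoid.of w * V' ∧ V'.length = m := by
      cases V using FreeMonoid.casesOn with
      | one => simp at hV
      | of_mul w V' => exact ⟨w, V', rfl, by simpa [add_comm 1] using hV⟩
    obtain ⟨w, V, rfl, hV⟩ := hcons W hm
    obtain ⟨w', V', rfl, hV'⟩ := hcons W' (hlen.symm.trans hm)
    rw [map_mul, map_mul, flatten_of, flatten_of] at h
    obtain hm0 | hm0 := Nat.eq_zero_or_pos m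
    · subst hm0
      obtain rfl := FreeMonoid.length_eq_zero.1 hV
      obtain rfl := FreeMonoid.length_eq_zero.1 hV'
      rw [map_one, mul_one, mul_one] at h
      rw [NormalWord.ext_cocycle hr h, sub_self]
      exact J.zero_mem
    classical
    have hle : cocycle hr w.1 ≤ cocycle hr (w.1 * flatten V) := by
      rw [cocycle_mul]; exact Multiset.le_add_right _ _
    have hle' : cocycle hr w'.1 ≤ cocycle hr (w.1 * flatten V) := by
      rw [h, cocycle_mul]; exact Multiset.le_add_right _ _
    -- The multiset Z stands for a common right multiple of w and w' of length exactly 2d that left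
    -- divides the whole word; m ≥ 1 ensures there is room.
    obtain ⟨Z, hUZ, hZM, hZ⟩ := exists_between_card_eq (n := 2 * d) (Multiset.union_le hle hle')
      (by
        have := Multiset.card_le_card
          (Multiset.union_le_add (cocycle hr w.1) (cocycle hr w'.1))
        rw [Multiset.card_add, card_cocycle, card_cocycle, w.2.2, w'.2.2] at this
        omega)
      (by
        rw [card_cocycle, FreeMonoid.length_mul, w.2.2, length_flatten, hV, two_mul]
        exact Nat.add_le_add_left (Nat.le_mul_of_pos_left d hm0) d)
    have hdiv (x : NormalWord k r d) (hx : cocycle hr x.1 ≤ Z) :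
        ∃ a : NormalWord k r d, cocycle hr (x.1 * a.1) = Z := by
      obtain ⟨v, hv⟩ := exists_cocycle_mul hr hx
      obtain ⟨a, ha⟩ := exists_normalWord k hr (m := d) (M := cocycle hr v) (by
        rw [← hv, card_cocycle, FreeMonoid.length_mul, x.2.2] at hZ
        rw [card_cocycle]
        omega)
      exact ⟨a, by rw [← hv, cocycle_mul, cocycle_mul, ha]⟩
    obtain ⟨a, ha⟩ := hdiv w ((Multiset.le_union_left).trans hUZ)
    obtain ⟨a', ha'⟩ := hdiv w' ((Multiset.le_union_right).trans hUZ)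
    obtain ⟨t, ht⟩ := exists_cocycle_mul hr (ha ▸ hZM)
    obtain ⟨T, hT, hTt⟩ := exists_flatten (k := k) (d := d) hr (m - 1) (M := cocycle hr t) (by
      have := congrArg Multiset.card ht
      rw [card_cocycle, card_cocycle, FreeMonoid.length_mul, FreeMonoid.length_mul,
        FreeMonoid.length_mul, w.2.2, a.2.2, length_flatten, hV] at this
      rw [card_cocycle, Nat.sub_mul, one_mul]
      omega)
    have hpair : ybCon r (concat (w, a)) (concat (w', a')) :=
      ybCon_of_cocycle_eq hr (ha.trans ha'.symm)
    -- Cancelling x on the left leaves two congruent words with m generators, to which the induction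
    -- hypothesis applies.
    have htail (x b : NormalWord k r d) (U : FreeMonoid (NormalWord k r d)) (hU : U.length = m)
        (hb : ybCon r (w.1 * a.1) (x.1 * b.1))
        (hx : cocycle hr (x.1 * flatten U) = cocycle hr (w.1 * flatten V)) :
        mon k U - mon k (FreeMonoid.of b * T) ∈ J := by
      refine ih _ _ ?_ ?_ hU
      · refine cocycle_eq_of_ybCon hr (ybCon_mul_left_cancel hr (u := x.1)
          (ybCon_of_cocycle_eq hr ?_))
        rw [hx, ← ht, map_mul, flatten_of, ← mul_assoc,
          cocycle_eq_of_ybCon hr ((ybCon r).mul ((ybCon r).symm hb) ((ybCon r).refl _)),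
          cocycle_mul, cocycle_mul _ (w.1 * a.1), hTt]
      · rw [hU, FreeMonoid.length_mul, FreeMonoid.length_of, hT]
        omega
    have h1 := htail w a V hV ((ybCon r).refl _) rfl
    have h2 := htail w' a' V' hV' hpair h.symm
    have h3 := hJ _ _ hpair
    -- wV - w'V' = w(V - aT) - w'(V' - a'T) + (wa - w'a')T.
    have h4 := J.add_mem (J.sub_mem (J.mul_mem_left (mon k (FreeMonoid.of w)) _ h1)
      (J.mul_mem_left (mon k (FreeMonoid.of w')) _ h2)) (J.mul_mem_right _ (mon k T) h3)
    convert h4 using 1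
    simp only [binomial, pairWord, mon, map_mul]
    noncomm_ring

theorem ker_evalHom_eq (hr : IsSolution r) (hd : 0 < d) :
    TwoSidedIdeal.ker (evalHom (veroneseGen k r d) : Free k _ →ₐ[k] YBAlgebra k r)
      = TwoSidedIdeal.span (relA' k r d ∪ relB k r d) := by
  apply le_antisymm
  · intro f hf
    refine mem_of_mapDomain_eq_zero _ _ (fun W W' h => ?_) ((mem_ker_evalHom_iff hr).1 hf)
    refine mon_sub_mon_mem_of_cocycle_eq hr (fun p q hpq => ?_) hd W W' h
    have h1 : Submodule.span k (relA' k r d ∪ relB k r d)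
        ≤ idealSubmodule (TwoSidedIdeal.span (relA' k r d ∪ relB k r d)) :=
      Submodule.span_le.2 TwoSidedIdeal.subset_span
    exact h1 (binomial_mem_span hr hpq)
  · rw [relA'_union_relB_eq hr]
    refine TwoSidedIdeal.span_le.2 ?_
    rintro _ ⟨p, hp, rfl⟩
    rw [SetLike.mem_coe, TwoSidedIdeal.mem_ker, evalHom_veroneseGen, expand_binomial,
      ← map_zero (ybMk k r), ybMk_eq_iff, sub_zero, mon_sub_mon_mem_iff hr, concat_normalPair,
      cocycle_norWord]

theorem map_homog_evalHom (hr : IsSolution r) (m : ℕ) :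
    (homog k (NormalWord k r d) m).map
      (evalHom (veroneseGen k r d) : Free k _ →ₐ[k] YBAlgebra k r).toLinearMap
      = ybComp k r (m * d) := by
  rw [homog, Submodule.map_span, Set.image_image, ybComp_eq_span]
  congr 1
  ext a
  constructor
  · rintro ⟨W, rfl, rfl⟩
    refine ⟨flatten W, length_flatten W, ?_⟩
    change ybMk k r (mon k (flatten W)) = evalHom (veroneseGen k r d) (mon k W)
    rw [evalHom_veroneseGen, expand_mon]
  · rintro ⟨w, hw, rfl⟩
    obtain ⟨W, rfl, hWw⟩ := exists_flatten (k := k) (d := d) hr m (M := cocycle hr w)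
      ((card_cocycle hr w).trans hw)
    refine ⟨W, rfl, ?_⟩
    change evalHom (veroneseGen k r d) (mon k W) = _
    rw [evalHom_veroneseGen, expand_mon, ybMk_eq_iff, mon_sub_mon_mem_iff hr, hWw]

theorem span_range_veroneseGen (hr : IsSolution r) :
    Submodule.span k (Set.range (veroneseGen k r d)) = ybComp k r (1 * d) := by
  rw [one_mul, ybComp_eq_span]
  congr 1
  ext a
  constructor
  · rintro ⟨w, rfl⟩
    exact ⟨w.1, w.2.2, rfl⟩
  · rintro ⟨w, hw, rfl⟩
    obtain ⟨u, hu⟩ := exists_normalWord k hr (m := d) ((card_cocycle hr w).trans hw)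
    exact ⟨u, ybMk_eq_iff.2 ((mon_sub_mon_mem_iff hr).2 hu)⟩

/-- Normal words have distinct values of π, so each fibre sum of a combination is a single
coefficient. -/
theorem linearIndependent_veroneseGen (hr : IsSolution r) :
    LinearIndependent k (veroneseGen k r d) := by
  have h (l : NormalWord k r d →₀ k) : Finsupp.linearCombination k (veroneseGen k r d) l
      = ybMk k r (MonoidAlgebra.ofCoeff (l.mapDomain Subtype.val)) := by
    induction l using Finsupp.induction_linear with
    | zero => simp
    | add f g hf hg => rw [map_add, hf, hg, Finsupp.mapDomain_add, MonoidAlgebra.ofCoeff_add,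
        map_add]
    | single w c =>
      have h : MonoidAlgebra.ofCoeff (Finsupp.single w.1 c) = c • mon k w.1 := by
        simp [MonoidAlgebra.smul_single]
      rw [Finsupp.linearCombination_single, Finsupp.mapDomain_single, h, map_smul, veroneseGen]
  rw [linearIndependent_iff]
  intro l hl
  rw [h, ← map_zero (ybMk k r), ybMk_eq_iff, sub_zero, mem_ybIdeal_iff hr,
    MonoidAlgebra.coeff_ofCoeff, ← Finsupp.mapDomain_comp] at hl
  have hinj : Function.Injective (cocycle hr ∘ Subtype.val : NormalWord k r d → Multiset X) :=
    fun u v e => NormalWord.ext_cocycle hr e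
  exact Finsupp.mapDomain_injective hinj (hl.trans Finsupp.mapDomain_zero.symm)

/-- Only the ideal generated by R and its degree matter, so both presentations are instances. -/
theorem isQuadraticPresentation (hr : IsSolution r) (hd : 0 < d)
    {R : Set (Free k (NormalWord k r d))}
    (hR : TwoSidedIdeal.span R = TwoSidedIdeal.span (relA' k r d ∪ relB k r d))
    (hR2 : R ⊆ homog k (NormalWord k r d) 2) :
    IsQuadraticPresentation (veronese k r d) (fun m => ybComp k r (m * d)) (veroneseGen k r d)
      R where
  grading_indep := iSupIndep_ybComp hr hd
  grading_sup := by simp [veronese]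
  gen_linearIndependent := linearIndependent_veroneseGen hr
  gen_span := span_range_veroneseGen hr
  range_eq := by
    apply Subalgebra.toSubmodule_injective
    rw [← Algebra.map_top, Subalgebra.map_toSubmodule, Algebra.top_toSubmodule, ← iSup_homog,
      Submodule.map_iSup]
    simp only [map_homog_evalHom hr]
    simp [veronese]
  graded := map_homog_evalHom hr
  quadratic := hR2
  ker_eq := (ker_evalHom_eq hr hd).trans hR.symm

end Presentation

end YBVeronese

/-! ### The main theorem -/

open YBVeronese

theorem mainTheorem1 {k : Type*} [Field k] {X : Type*} [Fintype X] [LinearOrder X] [Nonempty X]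
    (r : X × X → X × X) (hr : YBVeronese.IsSolution r) (n d N : ℕ) (hn : Fintype.card X = n)
    (hd : 2 ≤ d) (hN : N = (n + d - 1).choose d) :
    -- the generating set has `N` elements
    Nat.card (YBVeronese.NormalWord k r d) = N ∧
    -- `R = R_a ∪ R_b` presents the Veronese subalgebra; it is linearly independent, of the
    -- stated size, also as a set of polynomials in `X`
    YBVeronese.IsQuadraticPresentation (YBVeronese.veronese k r d)
      (fun m => YBVeronese.ybComp k r (m * d)) (YBVeronese.veroneseGen k r d)
      (YBVeronese.relA k r d ∪ YBVeronese.relB k r d) ∧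
    (YBVeronese.relA k r d ∪ YBVeronese.relB k r d).ncard + (n + 2 * d - 1).choose (n - 1)
      = N ^ 2 ∧
    LinearIndependent k (fun g : ↥(YBVeronese.relA k r d ∪ YBVeronese.relB k r d) => g.1) ∧
    LinearIndependent k (fun g : ↥(YBVeronese.relA k r d ∪ YBVeronese.relB k r d) =>
      YBVeronese.expand k r d g.1) ∧
    Disjoint (YBVeronese.relA k r d) (YBVeronese.relB k r d) ∧
    -- `R_a` corresponds to the nontrivial orbits of `ρ`
    (YBVeronese.relA k r d).ncard = N.choose 2 ∧
    Function.Involutive (YBVeronese.rho k r d) ∧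
    (∀ p, YBVeronese.rho k r d p ≠ p →
      Xor (p ∈ YBVeronese.setH k r d) (YBVeronese.rho k r d p ∈ YBVeronese.setH k r d)) ∧
    (∀ p, YBVeronese.rho k r d p ≠ p →
      ∃! g, g ∈ YBVeronese.relA k r d ∧ g.coeff (YBVeronese.pairWord p) ≠ 0) ∧
    (∀ p ∈ YBVeronese.setH k r d,
      YBVeronese.DegLex (YBVeronese.concat (YBVeronese.rho k r d p)) (YBVeronese.concat p) ∧
      YBVeronese.IsLM (YBVeronese.expand k r d
        (YBVeronese.binomial k p (YBVeronese.rho k r d p))) (YBVeronese.concat p)) ∧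
    -- `R_b` is indexed by `MV(n,d)`
    (YBVeronese.relB k r d).ncard + (n + 2 * d - 1).choose (n - 1) = (N + 1).choose 2 ∧
    (∀ p ∈ YBVeronese.setMV k r d, ∃! q, q ∈ YBVeronese.setC k r d ∧
      YBVeronese.concat q = YBVeronese.norWord k r (YBVeronese.concat p)) ∧
    (∀ p ∈ YBVeronese.setMV k r d, ∀ q ∈ YBVeronese.setC k r d,
      YBVeronese.concat q = YBVeronese.norWord k r (YBVeronese.concat p) →
      YBVeronese.DegLex (YBVeronese.concat q) (YBVeronese.concat p) ∧
      YBVeronese.IsLM (YBVeronese.expand k r d (YBVeronese.binomial k p q))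
        (YBVeronese.concat p)) ∧
    -- the second set of relations `R_1 = R_{1a} ∪ R_b`
    YBVeronese.IsQuadraticPresentation (YBVeronese.veronese k r d)
      (fun m => YBVeronese.ybComp k r (m * d)) (YBVeronese.veroneseGen k r d)
      (YBVeronese.relA' k r d ∪ YBVeronese.relB k r d) ∧
    LinearIndependent k (fun g : ↥(YBVeronese.relA' k r d ∪ YBVeronese.relB k r d) => g.1) ∧
    LinearIndependent k (fun g : ↥(YBVeronese.relA' k r d ∪ YBVeronese.relB k r d) =>
      YBVeronese.expand k r d g.1) ∧
    Disjoint (YBVeronese.relA' k r d) (YBVeronese.relB k r d) ∧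
    (YBVeronese.relA' k r d).ncard = N.choose 2 ∧
    (∀ p ∈ YBVeronese.setH k r d, ∃! q, q ∈ YBVeronese.setC k r d ∧
      YBVeronese.concat q = YBVeronese.norWord k r (YBVeronese.concat p)) ∧
    (∀ p ∈ YBVeronese.setH k r d, ∀ q ∈ YBVeronese.setC k r d,
      YBVeronese.concat q = YBVeronese.norWord k r (YBVeronese.concat p) →
      YBVeronese.DegLex (YBVeronese.concat q) (YBVeronese.concat p) ∧
      YBVeronese.IsLM (YBVeronese.expand k r d (YBVeronese.binomial k p q))
        (YBVeronese.concat p)) ∧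
    -- the two sets of relations are equivalent
    Submodule.span k (YBVeronese.relA k r d ∪ YBVeronese.relB k r d)
      = Submodule.span k (YBVeronese.relA' k r d ∪ YBVeronese.relB k r d) ∧
    TwoSidedIdeal.span (YBVeronese.relA k r d ∪ YBVeronese.relB k r d)
      = TwoSidedIdeal.span (YBVeronese.relA' k r d ∪ YBVeronese.relB k r d) := by
  subst hn hN
  have hd0 : 0 < d := by omega
  have hN : Nat.card (NormalWord k r d) = (Fintype.card X + d - 1).choose d := card_normalWord hr d
  have hfin := finite_normalWord k hr d
  have hC : Nat.card (NormalWord k r (2 * d))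
      = (Fintype.card X + 2 * d - 1).choose (Fintype.card X - 1) := by
    -- Nonemptiness of X is needed for the symmetry of the binomial coefficient, since n - 1 is
    -- truncated.
    have hpos : 0 < Fintype.card X := Fintype.card_pos
    rw [card_normalWord hr, ← Nat.choose_symm (by omega)]
    congr 1
    omega
  have hAd : Disjoint (relA k r d) (relB k r d) := by
    rw [relA_eq]
    exact disjoint_image_binomial hr fun p hp => degLex_concat_of_mem_setH hp
  have hA'd : Disjoint (relA' k r d) (relB k r d) := by
    rw [relA'_eq hr]
    exact disjoint_image_binomial hr fun p hp => degLex_normalPair hr (Or.inl hp)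
  have hA : (relA k r d).ncard = ((Fintype.card X + d - 1).choose d).choose 2 := by
    rw [relA_eq, ncard_image_binomial fun p hp => degLex_concat_of_mem_setH hp, ncard_setH hr, hN]
  have hA' : (relA' k r d).ncard = ((Fintype.card X + d - 1).choose d).choose 2 := by
    rw [relA'_eq hr, ncard_image_binomial fun p hp => degLex_normalPair hr (Or.inl hp),
      ncard_setH hr, hN]
  have hB : (relB k r d).ncard + (Fintype.card X + 2 * d - 1).choose (Fintype.card X - 1)
      = ((Fintype.card X + d - 1).choose d + 1).choose 2 := by
    rw [relB_eq hr, ncard_image_binomial fun p hp => degLex_normalPair hr (Or.inr hp), ← hC, ← hN,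
      ncard_setMV_add hr]
  have hLI : LinearIndependent k (fun g : ↥(relA k r d ∪ relB k r d) => expand k r d g.1) := by
    rw [relA_union_relB_eq hr]
    exact linearIndependent_expand_image_binomial fun p hp => degLex_reduction hr hp
  have hLI' : LinearIndependent k (fun g : ↥(relA' k r d ∪ relB k r d) => expand k r d g.1) := by
    rw [relA'_union_relB_eq hr]
    exact linearIndependent_expand_image_binomial fun p hp => degLex_normalPair hr hp
  have hcard : (relA k r d ∪ relB k r d).ncard
      + (Fintype.card X + 2 * d - 1).choose (Fintype.card X - 1)
      = (Fintype.card X + d - 1).choose d ^ 2 := by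
    have hAfin : (relA k r d).Finite := by rw [relA_eq]; exact (Set.toFinite _).image _
    have hBfin : (relB k r d).Finite := by rw [relB_eq hr]; exact (Set.toFinite _).image _
    -- The count reduces to C(N,2) + (N + C(N,2)) = N².
    rw [Set.ncard_union_eq hAd hAfin hBfin, add_assoc, hB, hA, Nat.choose_succ_succ' _ 1,
      Nat.choose_one_right]
    generalize (Fintype.card X + d - 1).choose d = N
    rw [Nat.choose_two_right]
    have h := Nat.div_mul_cancel (Nat.even_mul_pred_self N).two_dvd
    cases N with
    | zero => rfl
    | succ N =>
      rw [Nat.add_sub_cancel] at *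
      linarith
  refine ⟨hN, isQuadraticPresentation hr hd0 (idealSpan_relA_union_relB hr) ?_, hcard,
    linearIndependent_of_expand hLI, hLI, hAd, hA, rho_involutive hr,
    fun p hp => xor_mem_setH hr hp, fun p hp => existsUnique_relA hr hp,
    fun p hp => ⟨degLex_concat_of_mem_setH hp,
      isLM_expand_binomial (degLex_concat_of_mem_setH hp)⟩, hB,
    fun p _ => existsUnique_mem_setC hr p, fun p hp q _ h => ?_,
    isQuadraticPresentation hr hd0 rfl ?_, linearIndependent_of_expand hLI', hLI', hA'd, hA',
    fun p _ => existsUnique_mem_setC hr p, fun p hp q _ h => ?_,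
    span_relA_union_relB hr, idealSpan_relA_union_relB hr⟩
  · rw [relA_union_relB_eq hr]
    rintro _ ⟨p, -, rfl⟩
    exact binomial_mem_homog _ _
  · have h1 := degLex_of_concat_eq_norWord hr (Or.inr hp) h
    exact ⟨h1, isLM_expand_binomial h1⟩
  · rw [relA'_union_relB_eq hr]
    rintro _ ⟨p, -, rfl⟩
    exact binomial_mem_homog _ _
  · have h1 := degLex_of_concat_eq_norWord hr (Or.inl hp) h
    exact ⟨h1, isLM_expand_binomial h1⟩
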